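/- Let $\mathcal S^n$ be the space of real symmetric $n\times n$ matrices with the Frobenius inner product $\langle\cdot,\cdot\rangle$ and norm $\|\cdot\|$, let $\mathcal S^n_+$ and $\mathcal S^n_-$ be the cones of positive and of negative semidefinite matrices, $\Pi_{\mathcal S^n_-}$ the metric projection onto $\mathcal S^n_-$, $N_{\mathcal S^n_+}$ the normal cone mapping of $\mathcal S^n_+$, and $\delta=\delta_{\mathcal S^n_+}$ the indicator function of $\mathcal S^n_+$ ($0$ on $\mathcal S^n_+$ and $+\infty$ elsewhere). For $f:\mathcal S^n\to[-\infty,+\infty]$ and $\rho>0$ let $e_\rho f(Y)=\inf_{Z\in\mathcal S^n}\{f(Z)+\frac1{2\rho}\|Z-Y\|^2\}$ be the Moreau envelope, $e\delta:=e_1\delta$, and for $f(X)$ finite let $$\mathrm d^2f(X,\Gamma)(W)=\liminf_{t\downarrow0,\;W'\to W}\frac{f(X+tW')-f(X)-t\langle\Gamma,W'\rangle}{\frac12t^2}$$ be the second subderivative. Let $\lambda_1(A)\ge\dots\ge\lambda_n(A)$ denote the ordered eigenvalues of $A\in\mathcal S^n$. Write $\pi(A)=\pi(\bar A)$ if $A$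 and $\bar A$ have the same index sets of distinct eigenvalues, that is, $\lambda_i(A)=\lambda_j(A)\iff\lambda_i(\bar A)=\lambda_j(\bar A)$ for all $i,j$, and the same index sets $\alpha=\{i:\lambda_i>0\}$, $\beta=\{i:\lambda_i=0\}$, $\gamma=\{i:\lambda_i<0\}$. Let $G$ be a mapping with values in $\mathcal S^n$, let $\bar x$ be a point of its domain, let $\bar\Gamma\in N_{\mathcal S^n_+}(G(\bar x))$ (in particular $G(\bar x)\in\mathcal S^n_+$), and put $\bar A=G(\bar x)+\bar\Gamma$. Let $r>0$ satisfy $r<\frac13(v-v')$ for any two eigenvalues $v>v'$ of $\bar A$, and $r<|v|$ for every negative eigenvalue $v$ of $\bar A$. Then there are constants $l>0$ and $\delta_0>0$ such that for every $A=G(\bar x)+\Gamma$ with $\Gamma\in N_{\mathcal S^n_+}(G(\bar x))$, $\|A-\bar A\|\le r$ and $\pi(A)=\pi(\bar A)$, and for every $H\in\mathcal S^n$ with $\|H\|\le\delta_0$, the values $e\delta(A+H)$, $e\delta(A)$ and $e_{1/2}\big(\mathrm d^2\delta(G(\bar x),\Gamma)\big)(H)$ are finite and $$\Big|\,e\delta(A+H)-e\delta(A)-\langle\Pi_{\mathcal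 S^n_-}(A),H\rangle-\tfrac12\,e_{1/2}\big(\mathrm d^2\delta(G(\bar x),\Gamma)\big)(H)\Big|\le l\,\|H\|^3 .$$ That is, the expansion $e\delta(A+H)-e\delta(A)=\langle\Pi_{\mathcal S^n_-}(A),H\rangle+\frac12e_{1/2}(\mathrm d^2\delta(G(\bar x),\Gamma))(H)+O(\|H\|^3)$ holds with $O(\|H\|^3)$ uniform over all such $A$. -/

import Mathlib

open Filter Topology

/-! ### The space of symmetric matrices with the Frobenius inner product -/

/-- The subspace of symmetric matrices. -/
def symSubmodule (n : ℕ) : Submodule ℝ (Matrix (Fin n) (Fin n) ℝ) where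
  carrier := {A | A.IsSymm}
  add_mem' hA hB := hA.add hB
  zero_mem' := Matrix.isSymm_zero
  smul_mem' c _ hA := hA.smul c

/-- The space `𝒮ⁿ` of real symmetric `n × n` matrices. It is made a Euclidean space below, with
the Frobenius inner product. -/
def SymMat (n : ℕ) : Type := symSubmodule n

noncomputable instance SymMat.instAddCommGroup (n : ℕ) : AddCommGroup (SymMat n) :=
  inferInstanceAs (AddCommGroup (symSubmodule n))

noncomputable instance SymMat.instModule (n : ℕ) : Module ℝ (SymMat n) :=
  inferInstanceAs (Module ℝ (symSubmodule n))

/-- The underlying matrix. -/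
def SymMat.mat {n : ℕ} (A : SymMat n) : Matrix (Fin n) (Fin n) ℝ := A.1

theorem SymMat.mat_isSymm {n : ℕ} (A : SymMat n) : A.mat.IsSymm := A.2

/-- The Frobenius inner product `⟨A, B⟩ = ∑ i j, A i j * B i j = tr (Aᵀ B)`. -/
@[reducible] noncomputable def SymMat.frobeniusCore (n : ℕ) :
    InnerProductSpace.Core ℝ (SymMat n) where
  inner A B := ∑ i, ∑ j, A.mat i j * B.mat i j
  conj_inner_symm A B := by simp [mul_comm]
  re_inner_nonneg A := by
    have h : 0 ≤ ∑ i, ∑ j, A.mat i j * A.mat i j :=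
      Finset.sum_nonneg fun i _ => Finset.sum_nonneg fun j _ => mul_self_nonneg _
    simpa using h
  add_left A B C := by
    have h : (A + B).mat = A.mat + B.mat := rfl
    simp [h, add_mul, Finset.sum_add_distrib]
  smul_left A B c := by
    have h : (c • A).mat = c • A.mat := rfl
    simp [h, Finset.mul_sum, mul_assoc]
  definite A h := by
    have h0 : ∀ i, ∀ j, A.mat i j = 0 := by
      intro i j
      have h1 := (Finset.sum_eq_zero_iff_of_nonneg fun i _ =>
        Finset.sum_nonneg fun j _ => mul_self_nonneg (A.mat i j)).1 h i (Finset.mem_univ i)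
      have h2 := (Finset.sum_eq_zero_iff_of_nonneg fun j _ =>
        mul_self_nonneg (A.mat i j)).1 h1 j (Finset.mem_univ j)
      exact mul_self_eq_zero.1 h2
    exact Subtype.ext (Matrix.ext h0)

/-- The Frobenius norm, induced by the Frobenius inner product. -/
noncomputable instance SymMat.instNormedAddCommGroup (n : ℕ) : NormedAddCommGroup (SymMat n) :=
  (SymMat.frobeniusCore n).toNormedAddCommGroup

noncomputable instance SymMat.instInnerProductSpace (n : ℕ) : InnerProductSpace ℝ (SymMat n) :=
  InnerProductSpace.ofCore (SymMat.frobeniusCore n).toCore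

instance SymMat.instFiniteDimensional (n : ℕ) : FiniteDimensional ℝ (SymMat n) :=
  inferInstanceAs (FiniteDimensional ℝ (symSubmodule n))

theorem SymMat.inner_def {n : ℕ} (A B : SymMat n) :
    inner ℝ A B = ∑ i, ∑ j, A.mat i j * B.mat i j := rfl

theorem SymMat.isHermitian {n : ℕ} (A : SymMat n) :
    A.mat.IsHermitian := by
  have h : A.mat.IsSymm := A.2
  rwa [Matrix.IsHermitian, Matrix.conjTranspose_eq_transpose_of_trivial]

/-- The eigenvalues `λ₁(A) ≥ λ₂(A) ≥ … ≥ λₙ(A)` in nonincreasing order, counting multiplicity. -/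
noncomputable def SymMat.eig {n : ℕ} (A : SymMat n) : Fin (Fintype.card (Fin n)) → ℝ :=
  A.isHermitian.eigenvalues₀

/-- `𝒮ⁿ₊`. -/
noncomputable def psdCone (n : ℕ) : Set (SymMat n) :=
  {A | A.mat.PosSemidef}

/-- `𝒮ⁿ₋`. -/
noncomputable def nsdCone (n : ℕ) : Set (SymMat n) :=
  {A | (-A.mat).PosSemidef}

/-- `π(A) = π(B)`: the ordered eigenvalues of `A` and `B` have the same index sets of distinct
eigenvalues, and the same index sets of positive, of zero and of negative eigenvalues. Since the
eigenvalues are sorted, the first condition says that the blocks of equal eigenvalues agree, in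
the same order. -/
def SamePartition {n : ℕ} (A B : SymMat n) : Prop :=
  (∀ i j, A.eig i = A.eig j ↔ B.eig i = B.eig j) ∧
  {i | 0 < A.eig i} = {i | 0 < B.eig i} ∧
  {i | A.eig i = 0} = {i | B.eig i = 0} ∧
  {i | A.eig i < 0} = {i | B.eig i < 0}

/-! ### Variational analysis on a Euclidean space -/

section Variational

variable {E : Type*} [NormedAddCommGroup E] [InnerProductSpace ℝ E]

/-- The normal cone of a convex set `C` at `x` (empty when `x ∉ C`). -/
noncomputable def normalCone (C : Set E) (x : E) : Set E :=
  {v | x ∈ C ∧ ∀ x' ∈ C, inner ℝ v (x' - x) ≤ 0}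

open Classical in
/-- The indicator function `δ_C`: `0` on `C` and `+∞` outside. -/
noncomputable def convIndicator (C : Set E) (x : E) : EReal :=
  if x ∈ C then 0 else ⊤

/-- The metric projection onto `C`: a point of `C` nearest to `y`. It exists and is unique when
`C` is nonempty, closed and convex and `E` is finite-dimensional. -/
noncomputable def metricProj (C : Set E) (y : E) : E :=
  Classical.epsilon fun x => x ∈ C ∧ ∀ z ∈ C, ‖y - x‖ ≤ ‖y - z‖

/-- The Moreau envelope `e_ρ f (y) = inf_x { f x + ‖x - y‖² / (2ρ) }`. -/
noncomputable def moreauEnv (ρ : ℝ) (f : E → EReal) (y : E) : EReal :=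
  ⨅ x : E, f x + ((1 / (2 * ρ) * ‖x - y‖ ^ 2 : ℝ) : EReal)

/-- The second subderivative of `f` at `x` for `v`: the lower limit, as `t ↓ 0` and `w' → w`, of
`(f (x + t w') - f x - t ⟨v, w'⟩) / (t² / 2)`. -/
noncomputable def secondSubderiv (f : E → EReal) (x v w : E) : EReal :=
  liminf (fun p : ℝ × E =>
      (f (x + p.1 • p.2) - f x - ((p.1 * inner ℝ v p.2 : ℝ) : EReal)) /
        ((p.1 ^ 2 / 2 : ℝ) : EReal))
    (𝓝[>] (0 : ℝ) ×ˢ 𝓝 w)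

end Variational

/-!
Write `X = G xbar` and `X + Γ + H = Z + N` with `N` normal to the positive semidefinite cone at `Z`,
and put `W = Z - X`. Twice the first-order remainder `eδ (X + Γ + H) - eδ (X + Γ) - ⟪Γ, H⟫` equals
`‖W - H‖² - 2 ⟪Γ, W⟫`, and `W` minimises this expression over all `V` with `X + V` in the cone.
Similarly, the envelope of the second subderivative is the minimum over the critical cone of
`‖V - H‖²` plus a curvature term quadratic in `V`. A critical direction becomes feasible after
adding a second-order correction, and `W` becomes critical after changing one block of size
`O(κ ‖H‖²)`; either change costs `O(κ ‖H‖³)` in the objective, where `κ⁻¹` is the least absolute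
value of a nonzero eigenvalue of `X + Γ`. Uniformity in `Γ` is a bound on `κ`: the positive
eigenvalues of `X + Γ` are those of `X`, and by Weyl's inequality each negative one is within `r`
of a negative eigenvalue of `X + Γbar`, hence bounded away from zero.
-/

theorem norm_add_sq_le_of_norm_le {E : Type*} [SeminormedAddGroup E] {a b : E} {α β : ℝ}
    (ha : ‖a‖ ≤ α) (hb : ‖b‖ ≤ β) : ‖a + b‖ ^ 2 ≤ ‖a‖ ^ 2 + 2 * α * β + β ^ 2 := by
  calc ‖a + b‖ ^ 2 ≤ (‖a‖ + ‖b‖) ^ 2 := by gcongr; exact norm_add_le a b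
    _ = ‖a‖ ^ 2 + 2 * ‖a‖ * ‖b‖ + ‖b‖ ^ 2 := add_sq _ _
    _ ≤ ‖a‖ ^ 2 + 2 * α * β + β ^ 2 := by
      have := (norm_nonneg a).trans ha
      gcongr

section ConvexAnalysis

open scoped RealInnerProductSpace

variable {E : Type*} [NormedAddCommGroup E] [InnerProductSpace ℝ E] {C : Set E} {x z v w h : E}

theorem norm_sq_add_norm_sq_le_of_mem_normalCone (hv : v ∈ normalCone C x) {y : E} (hy : y ∈ C) :
    ‖y - x‖ ^ 2 + ‖v‖ ^ 2 ≤ ‖y - (x + v)‖ ^ 2 := by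
  rw [sub_add_eq_sub_sub, norm_sub_sq_real (y - x) v, real_inner_comm]
  linarith [hv.2 y hy]

theorem moreauEnv_convIndicator_add {ρ : ℝ} (hρ : 0 < ρ) (hv : v ∈ normalCone C x) :
    moreauEnv ρ (convIndicator C) (x + v) = ((1 / (2 * ρ) * ‖v‖ ^ 2 : ℝ) : EReal) := by
  refine le_antisymm ((iInf_le _ x).trans_eq ?_) (le_iInf fun y => ?_)
  · rw [convIndicator, if_pos hv.1, zero_add, sub_add_cancel_left, norm_neg]
  · by_cases hy : y ∈ C
    · rw [convIndicator, if_pos hy, zero_add, EReal.coe_le_coe_iff]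
      gcongr 1 / (2 * ρ) * ?_
      linarith [norm_sq_add_norm_sq_le_of_mem_normalCone hv hy, sq_nonneg ‖y - x‖]
    · simp only [convIndicator, if_neg hy, EReal.top_add_coe, le_top]

theorem metricProj_add (hv : v ∈ normalCone C x) : metricProj C (x + v) = x := by
  have hnear : ∀ y ∈ C, ‖x + v - x‖ ≤ ‖x + v - y‖ := fun y hy => by
    rw [add_sub_cancel_left, norm_sub_rev, ← sq_le_sq₀ (norm_nonneg _) (norm_nonneg _)]
    linarith [norm_sq_add_norm_sq_le_of_mem_normalCone hv hy, sq_nonneg ‖y - x‖]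
  have hproj : metricProj C (x + v) ∈ C ∧ ∀ y ∈ C, ‖x + v - metricProj C (x + v)‖ ≤ ‖x + v - y‖ :=
    Classical.epsilon_spec (p := fun p => p ∈ C ∧ ∀ y ∈ C, ‖x + v - p‖ ≤ ‖x + v - y‖)
      ⟨x, hv.1, hnear⟩
  have hle : ‖metricProj C (x + v) - (x + v)‖ ^ 2 ≤ ‖v‖ ^ 2 := by
    rw [norm_sub_rev]
    simpa only [add_sub_cancel_left] using pow_le_pow_left₀ (norm_nonneg _) (hproj.2 x hv.1) 2
  have hzero : ‖metricProj C (x + v) - x‖ ^ 2 = 0 :=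
    le_antisymm (by linarith [norm_sq_add_norm_sq_le_of_mem_normalCone hv hproj.1])
      (sq_nonneg _)
  rwa [sq_eq_zero_iff, norm_eq_zero, sub_eq_zero] at hzero

theorem inner_sub_sub_nonneg_of_mem_normalCone (hv : v ∈ normalCone C x)
    (hw : w ∈ normalCone C z) : 0 ≤ ⟪w - v, z - x⟫ := by
  have hwx := hw.2 x hv.1
  rw [← neg_sub, inner_neg_right] at hwx
  rw [inner_sub_left]
  linarith [hv.2 z hw.1]

theorem norm_sq_add_norm_sq_le_of_add_eq_add (hv : v ∈ normalCone C x) (hw : w ∈ normalCone C z)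
    (hsum : x + v + h = z + w) : ‖z - x‖ ^ 2 + ‖z - x - h‖ ^ 2 ≤ ‖h‖ ^ 2 := by
  obtain rfl : h = (z - x) + (w - v) := by rw [sub_add_sub_comm, ← hsum]; abel
  have hmono := inner_sub_sub_nonneg_of_mem_normalCone hv hw
  rw [sub_add_cancel_left, norm_neg, norm_add_sq_real, real_inner_comm]
  linarith

theorem norm_sq_sub_norm_sq_eq_of_add_eq_add (hsum : x + v + h = z + w) :
    ‖w‖ ^ 2 - ‖v‖ ^ 2 - 2 * ⟪v, h⟫ = ‖z - x - h‖ ^ 2 - 2 * ⟪v, z - x⟫ := by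
  obtain rfl : w = v - (z - x - h) := by
    rw [← sub_eq_of_eq_add' hsum]; abel
  rw [norm_sub_sq_real, inner_sub_right]
  ring

theorem norm_sq_sub_inner_le_of_mem_normalCone (hw : w ∈ normalCone C z)
    (hsum : x + v + h = z + w) {y : E} (hy : y ∈ C) :
    ‖z - x - h‖ ^ 2 - 2 * ⟪v, z - x⟫ ≤ ‖y - x - h‖ ^ 2 - 2 * ⟪v, y - x⟫ := by
  have hmin := norm_sq_add_norm_sq_le_of_mem_normalCone hw hy
  rw [← hsum, show y - (x + v + h) = y - x - h - v by abel, norm_sub_sq_real (y - x - h) v,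
    real_inner_comm, inner_sub_right v (y - x) h] at hmin
  have := norm_sq_sub_norm_sq_eq_of_add_eq_add hsum
  linarith [sq_nonneg ‖y - z‖]

theorem secondSubderiv_convIndicator_le_of_tendsto (hx : x ∈ C) {u : ℝ → E}
    (hu : Tendsto u (𝓝[>] 0) (𝓝 w)) {c : ℝ}
    (hfeas : ∀ᶠ t in 𝓝[>] (0 : ℝ), x + t • u t ∈ C ∧ -(2 * ⟪v, u t⟫) ≤ c * t) :
    secondSubderiv (convIndicator C) x v w ≤ (c : EReal) := by
  refine liminf_le_of_frequently_le' ((tendsto_id.prodMk hu).frequently (Eventually.frequently ?_))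
  filter_upwards [hfeas, self_mem_nhdsWithin] with t ⟨hmem, hle⟩ ht
  have ht : 0 < t := ht
  simp only [id_eq, convIndicator, if_pos hmem, if_pos hx]
  rw [sub_zero, zero_sub, ← EReal.coe_neg, ← EReal.coe_div, EReal.coe_le_coe_iff,
    div_le_iff₀ (by positivity)]
  nlinarith

theorem frequently_of_secondSubderiv_convIndicator_lt (hx : x ∈ C) {c : ℝ}
    (hlt : secondSubderiv (convIndicator C) x v w < (c : EReal)) :
    ∃ᶠ p in 𝓝[>] (0 : ℝ) ×ˢ 𝓝 w,
      0 < p.1 ∧ x + p.1 • p.2 ∈ C ∧ -(2 * ⟪v, p.2⟫) ≤ c * p.1 := by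
  have hpos : ∀ᶠ p : ℝ × E in 𝓝[>] (0 : ℝ) ×ˢ 𝓝 w, 0 < p.1 :=
    tendsto_fst.eventually self_mem_nhdsWithin
  refine ((frequently_lt_of_liminf_lt (by isBoundedDefault) hlt).and_eventually hpos).mono ?_
  rintro ⟨t, u⟩ ⟨hquot, ht : 0 < t⟩
  by_cases hmem : x + t • u ∈ C
  · refine ⟨ht, hmem, ?_⟩
    simp only [convIndicator, if_pos hmem, if_pos hx] at hquot
    rw [sub_zero, zero_sub, ← EReal.coe_neg, ← EReal.coe_div, EReal.coe_lt_coe_iff,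
      div_lt_iff₀ (by positivity)] at hquot
    exact le_of_mul_le_mul_left (by linarith) ht
  · simp only [convIndicator, if_neg hmem, if_pos hx] at hquot
    rw [sub_zero, EReal.top_sub_coe, EReal.top_div_of_pos_ne_top
      (mod_cast (by positivity : 0 < t ^ 2 / 2)) (EReal.coe_ne_top _)] at hquot
    exact absurd hquot not_top_lt

end ConvexAnalysis

section Weyl

variable {𝕜 E : Type*} [RCLike 𝕜] [NormedAddCommGroup E] [InnerProductSpace 𝕜 E]

theorem exists_ne_zero_forall_inner_eq_zero [FiniteDimensional 𝕜 E] {ι : Type*} [Fintype ι]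
    (v : ι → E) (hcard : Fintype.card ι < Module.finrank 𝕜 E) :
    ∃ x ≠ 0, ∀ k, inner 𝕜 (v k) x = 0 := by
  have hker : (LinearMap.pi fun k => (innerₛₗ 𝕜 (v k) : E →ₗ[𝕜] 𝕜)).ker ≠ ⊥ :=
    LinearMap.ker_ne_bot_of_finrank_lt (by rwa [Module.finrank_fintype_fun_eq_card])
  obtain ⟨x, hx, hx0⟩ := Submodule.exists_mem_ne_zero_of_ne_bot hker
  exact ⟨x, hx0, fun k => congrFun (LinearMap.mem_ker.mp hx) k⟩

variable [FiniteDimensional 𝕜 E] {n : ℕ} (hn : Module.finrank 𝕜 E = n) {T S : E →ₗ[𝕜] E}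
  (hT : T.IsSymmetric) (hS : S.IsSymmetric)

include hn in
theorem re_inner_apply_self_eq_sum_eigenvalues (x : E) :
    RCLike.re (inner 𝕜 (T x) x) =
      ∑ k, hT.eigenvalues hn k * ‖inner 𝕜 (hT.eigenvectorBasis hn k) x‖ ^ 2 := by
  rw [← (hT.eigenvectorBasis hn).sum_inner_mul_inner, map_sum]
  refine Finset.sum_congr rfl fun k _ => ?_
  rw [hT, hT.apply_eigenvectorBasis, inner_smul_right, mul_assoc, RCLike.re_ofReal_mul,
    inner_mul_symm_re_eq_norm, norm_mul, norm_inner_symm x, sq]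

theorem eigenvalues_mul_norm_sq_le {i : Fin n} {x : E}
    (hx : ∀ k, i < k → inner 𝕜 (hT.eigenvectorBasis hn k) x = 0) :
    hT.eigenvalues hn i * ‖x‖ ^ 2 ≤ RCLike.re (inner 𝕜 (T x) x) := by
  rw [re_inner_apply_self_eq_sum_eigenvalues hn hT,
    ← (hT.eigenvectorBasis hn).sum_sq_norm_inner_right, Finset.mul_sum]
  refine Finset.sum_le_sum fun k _ => ?_
  rcases le_or_gt k i with hk | hk
  · gcongr
    exact hT.eigenvalues_antitone hn hk
  · simp only [hx k hk, norm_zero, ne_eq, OfNat.ofNat_ne_zero, not_false_eq_true, zero_pow,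
      mul_zero, le_refl]

theorem re_inner_apply_self_le_eigenvalues_mul {i : Fin n} {x : E}
    (hx : ∀ k, k < i → inner 𝕜 (hT.eigenvectorBasis hn k) x = 0) :
    RCLike.re (inner 𝕜 (T x) x) ≤ hT.eigenvalues hn i * ‖x‖ ^ 2 := by
  rw [re_inner_apply_self_eq_sum_eigenvalues hn hT,
    ← (hT.eigenvectorBasis hn).sum_sq_norm_inner_right, Finset.mul_sum]
  refine Finset.sum_le_sum fun k _ => ?_
  rcases lt_or_ge k i with hk | hk
  · simp only [hx k hk, norm_zero, ne_eq, OfNat.ofNat_ne_zero, not_false_eq_true, zero_pow,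
      mul_zero, le_refl]
  · gcongr
    exact hT.eigenvalues_antitone hn hk

theorem eigenvalues_le_eigenvalues_add {c : ℝ}
    (hTS : ∀ x, RCLike.re (inner 𝕜 (T x) x) ≤ RCLike.re (inner 𝕜 (S x) x) + c * ‖x‖ ^ 2)
    (i : Fin n) : hT.eigenvalues hn i ≤ hS.eigenvalues hn i + c := by
  obtain ⟨x, hx0, hx⟩ := exists_ne_zero_forall_inner_eq_zero (𝕜 := 𝕜) (E := E)
    (fun k : {k : Fin n // k ≠ i} =>
      if i < k then hT.eigenvectorBasis hn k else hS.eigenvectorBasis hn k)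
    (by simpa [hn] using i.pos)
  have hxT : ∀ k, i < k → inner 𝕜 (hT.eigenvectorBasis hn k) x = 0 := fun k hk => by
    simpa only [if_pos hk] using hx ⟨k, hk.ne'⟩
  have hxS : ∀ k, k < i → inner 𝕜 (hS.eigenvectorBasis hn k) x = 0 := fun k hk => by
    simpa only [if_neg hk.not_gt] using hx ⟨k, hk.ne⟩
  have hpos : 0 < ‖x‖ ^ 2 := by positivity
  refine le_of_mul_le_mul_right ?_ hpos
  calc hT.eigenvalues hn i * ‖x‖ ^ 2 ≤ RCLike.re (inner 𝕜 (T x) x) :=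
        eigenvalues_mul_norm_sq_le hn hT hxT
    _ ≤ RCLike.re (inner 𝕜 (S x) x) + c * ‖x‖ ^ 2 := hTS x
    _ ≤ hS.eigenvalues hn i * ‖x‖ ^ 2 + c * ‖x‖ ^ 2 := by
        gcongr
        exact re_inner_apply_self_le_eigenvalues_mul hn hS hxS
    _ = (hS.eigenvalues hn i + c) * ‖x‖ ^ 2 := by ring

end Weyl

section FrobeniusNorm

open Matrix

attribute [local instance] Matrix.frobeniusNormedRing Matrix.frobeniusNormedAlgebra
  Matrix.frobeniusNormedAddCommGroup

section Frobenius

variable {l m : Type*} [Fintype l] [Fintype m]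

theorem frobenius_norm_sq_eq_sum (M : Matrix l m ℝ) : ‖M‖ ^ 2 = ∑ i, ∑ j, M i j ^ 2 := by
  rw [frobenius_norm_def, ← Real.sqrt_eq_rpow, Real.sq_sqrt (by positivity)]
  simp only [Real.rpow_ofNat, Real.norm_eq_abs, sq_abs]

theorem trace_mul_conjTranspose_self_eq_frobenius_norm_sq (M : Matrix l m ℝ) :
    (M * Mᴴ).trace = ‖M‖ ^ 2 := by
  rw [frobenius_norm_sq_eq_sum]
  simp only [trace, diag_apply, Matrix.mul_apply, conjTranspose_apply, star_trivial, sq]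

theorem abs_trace_mul_le_frobenius_norm_mul (M : Matrix l m ℝ) (N : Matrix m l ℝ) :
    |(M * N).trace| ≤ ‖M‖ * ‖N‖ := by
  refine abs_le_of_sq_le_sq ?_ (by positivity)
  rw [mul_pow, ← frobenius_norm_conjTranspose N, frobenius_norm_sq_eq_sum,
    frobenius_norm_sq_eq_sum]
  simp only [trace, diag_apply, Matrix.mul_apply, conjTranspose_apply, star_trivial,
    ← Fintype.sum_prod_type']
  exact Finset.sum_mul_sq_le_sq_mul_sq _ _ _

theorem norm_toEuclideanLin_apply_le_frobenius_norm [DecidableEq m] (M : Matrix l m ℝ)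
    (x : EuclideanSpace ℝ m) : ‖toEuclideanLin M x‖ ≤ ‖M‖ * ‖x‖ := by
  have := frobenius_norm_mul M (replicateCol Unit x.ofLp)
  rwa [← replicateCol_mulVec, frobenius_norm_replicateCol, frobenius_norm_replicateCol] at this

end Frobenius

section PosSemidef

variable {m : Type*} [Fintype m] {M N : Matrix m m ℝ}

open scoped MatrixOrder in
theorem exists_conjTranspose_mul_self_of_posSemidef (hM : M.PosSemidef) :
    ∃ B : Matrix m m ℝ, M = Bᴴ * B := by
  classical exact CStarAlgebra.nonneg_iff_eq_star_mul_self.mp hM.nonneg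

theorem trace_mul_nonneg_of_posSemidef (hM : M.PosSemidef) (hN : N.PosSemidef) :
    0 ≤ (M * N).trace := by
  obtain ⟨B, rfl⟩ := exists_conjTranspose_mul_self_of_posSemidef hM
  rw [Matrix.mul_assoc, trace_mul_comm]
  exact (hN.mul_mul_conjTranspose_same B).trace_nonneg

theorem mul_eq_zero_of_trace_mul_eq_zero (hM : M.PosSemidef) (hN : N.PosSemidef)
    (htr : (M * N).trace = 0) : M * N = 0 := by
  obtain ⟨B, rfl⟩ := exists_conjTranspose_mul_self_of_posSemidef hM
  obtain ⟨C, rfl⟩ := exists_conjTranspose_mul_self_of_posSemidef hN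
  have hBC : B * Cᴴ = 0 := by
    rw [← trace_mul_conjTranspose_self_eq_zero_iff, ← htr, conjTranspose_mul,
      conjTranspose_conjTranspose, Matrix.mul_assoc Bᴴ, trace_mul_comm Bᴴ]
    simp only [Matrix.mul_assoc]
  calc Bᴴ * B * (Cᴴ * C) = Bᴴ * (B * Cᴴ) * C := by simp only [Matrix.mul_assoc]
    _ = 0 := by rw [hBC, Matrix.mul_zero, Matrix.zero_mul]

theorem isClosed_setOf_posSemidef {ι : Type*} [Finite ι] :
    IsClosed {M : Matrix ι ι ℝ | M.PosSemidef} := by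
  cases nonempty_fintype ι
  simp only [posSemidef_iff_dotProduct_mulVec, IsHermitian, Set.ofPred_and, Set.ofPred_forall]
  refine (isClosed_eq (by fun_prop) continuous_id).inter (isClosed_iInter fun x => ?_)
  exact isClosed_le continuous_const (by fun_prop)

end PosSemidef

section FunctionalCalculus

variable {m : Type*} [Fintype m] [DecidableEq m] {A : Matrix m m ℝ}

theorem continuousOn_real_spectrum (A : Matrix m m ℝ) (f : ℝ → ℝ) :
    ContinuousOn f (spectrum ℝ A) := A.finite_real_spectrum.continuousOn f

theorem isHermitian_cfc (f : ℝ → ℝ) (A : Matrix m m ℝ) : (cfc f A).IsHermitian :=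
  cfc_predicate f A

open scoped MatrixOrder in
theorem posSemidef_cfc {f : ℝ → ℝ} (hf : ∀ μ ∈ spectrum ℝ A, 0 ≤ f μ) :
    (cfc f A).PosSemidef := (cfc_nonneg hf).posSemidef

theorem frobenius_norm_cfc_mul_le (hA : A.IsHermitian) {f : ℝ → ℝ} {κ : ℝ} (hκ : 0 ≤ κ)
    (hf : ∀ μ ∈ spectrum ℝ A, |f μ| ≤ κ) (M : Matrix m m ℝ) : ‖cfc f A * M‖ ≤ κ * ‖M‖ := by
  have hpsd : (κ ^ 2 • 1 - cfc f A * cfc f A).PosSemidef := by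
    have := posSemidef_cfc (A := A) (f := fun μ => κ ^ 2 - f μ * f μ) fun μ hμ => by
      nlinarith [sq_le_sq' (abs_le.mp (hf μ hμ)).1 (abs_le.mp (hf μ hμ)).2]
    rwa [cfc_sub _ _ A (continuousOn_real_spectrum A _) (continuousOn_real_spectrum A _),
      cfc_mul f f A (continuousOn_real_spectrum A _) (continuousOn_real_spectrum A _),
      cfc_const (κ ^ 2) A hA.isSelfAdjoint, Algebra.algebraMap_eq_smul_one] at this
  have htr := (hpsd.conjTranspose_mul_mul_same M).trace_nonneg
  have hexpand : (Mᴴ * (κ ^ 2 • 1 - cfc f A * cfc f A) * M).trace =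
      κ ^ 2 * (M * Mᴴ).trace - (cfc f A * M * (cfc f A * M)ᴴ).trace := by
    rw [conjTranspose_mul, (isHermitian_cfc f A).eq, ← Matrix.trace_mul_comm Mᴴ,
      ← Matrix.trace_mul_comm (Mᴴ * _)]
    simp only [Matrix.mul_sub, Matrix.sub_mul, Matrix.mul_smul, Matrix.smul_mul, Matrix.mul_one,
      trace_sub, trace_smul, smul_eq_mul, Matrix.mul_assoc]
  rw [hexpand, trace_mul_conjTranspose_self_eq_frobenius_norm_sq,
    trace_mul_conjTranspose_self_eq_frobenius_norm_sq] at htr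
  exact le_of_sq_le_sq (by rw [mul_pow]; linarith) (by positivity)

theorem frobenius_norm_mul_cfc_le (hA : A.IsHermitian) {f : ℝ → ℝ} {κ : ℝ} (hκ : 0 ≤ κ)
    (hf : ∀ μ ∈ spectrum ℝ A, |f μ| ≤ κ) (M : Matrix m m ℝ) : ‖M * cfc f A‖ ≤ κ * ‖M‖ := by
  rw [← frobenius_norm_conjTranspose, conjTranspose_mul, (isHermitian_cfc f A).eq,
    ← frobenius_norm_conjTranspose M]
  exact frobenius_norm_cfc_mul_le hA hκ hf Mᴴ

end FunctionalCalculus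

section Spectrum

variable {𝕜 R : Type*} [Field 𝕜] [Ring R] [Algebra 𝕜 R] {a b : R} {μ : 𝕜}

theorem mem_spectrum_add_iff_of_mul_eq_zero (hab : a * b = 0) (hba : b * a = 0) (hμ : μ ≠ 0) :
    μ ∈ spectrum 𝕜 (a + b) ↔ μ ∈ spectrum 𝕜 a ∨ μ ∈ spectrum 𝕜 b := by
  have hcomm : Commute (algebraMap 𝕜 R μ - a) (algebraMap 𝕜 R μ - b) :=
    (Algebra.commute_algebraMap_left μ _).sub_left
      ((Algebra.commute_algebraMap_right μ a).sub_right (hab.trans hba.symm))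
  have hfactor : (algebraMap 𝕜 R μ - a) * (algebraMap 𝕜 R μ - b) =
      algebraMap 𝕜 R μ * (algebraMap 𝕜 R μ - (a + b)) := by
    rw [sub_mul, mul_sub, mul_sub, hab, mul_sub, mul_add, ← Algebra.commutes μ a]; abel
  have hunit : IsUnit (algebraMap 𝕜 R μ) := (IsUnit.mk0 μ hμ).map (algebraMap 𝕜 R)
  rw [spectrum.mem_iff, spectrum.mem_iff, spectrum.mem_iff, ← not_and_or,
    ← hcomm.isUnit_mul_iff, hfactor, hunit.mul_left_iff]

end Spectrum

namespace SymMat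

open scoped RealInnerProductSpace

variable {n : ℕ}

@[simp] theorem mat_add (A B : SymMat n) : (A + B).mat = A.mat + B.mat := rfl
@[simp] theorem mat_sub (A B : SymMat n) : (A - B).mat = A.mat - B.mat := rfl
@[simp] theorem mat_zero : (0 : SymMat n).mat = 0 := rfl
@[simp] theorem mat_smul (c : ℝ) (A : SymMat n) : (c • A).mat = c • A.mat := rfl
theorem conjTranspose_mat (A : SymMat n) : A.matᴴ = A.mat := A.isHermitian

theorem mat_injective : Function.Injective (SymMat.mat (n := n)) := Subtype.val_injective

/-- The element of `SymMat n` with a given Hermitian underlying matrix. -/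
def ofMat (M : Matrix (Fin n) (Fin n) ℝ) (hM : M.IsHermitian) : SymMat n :=
  ⟨M, isHermitian_iff_isSymm.mp hM⟩

@[simp] theorem mat_ofMat {M : Matrix (Fin n) (Fin n) ℝ} (hM : M.IsHermitian) :
    (ofMat M hM).mat = M := rfl

theorem inner_eq_trace (A B : SymMat n) : ⟪A, B⟫ = (A.mat * B.mat).trace := by
  rw [inner_def, trace]
  simp only [diag_apply, Matrix.mul_apply]
  exact Finset.sum_congr rfl fun i _ => Finset.sum_congr rfl fun j _ => by
    rw [← B.mat_isSymm.apply i j]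

theorem norm_mat (A : SymMat n) : ‖A.mat‖ = ‖A‖ := by
  rw [← sq_eq_sq₀ (norm_nonneg _) (norm_nonneg _), ← real_inner_self_eq_norm_sq A, inner_eq_trace,
    ← trace_mul_conjTranspose_self_eq_frobenius_norm_sq, conjTranspose_mat]

theorem continuous_mat : Continuous (SymMat.mat (n := n)) :=
  (Isometry.of_dist_eq fun A B => by
    rw [dist_eq_norm, dist_eq_norm, ← mat_sub, norm_mat] : Isometry _).continuous

theorem eig_le_eig_add_norm_sub (A B : SymMat n) (i : Fin (Fintype.card (Fin n))) :
    A.eig i ≤ B.eig i + ‖A - B‖ := by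
  refine eigenvalues_le_eigenvalues_add finrank_euclideanSpace
    (isSymmetric_toEuclideanLin_iff.mpr A.isHermitian)
    (isSymmetric_toEuclideanLin_iff.mpr B.isHermitian) (fun x => ?_) i
  rw [← sub_le_iff_le_add', ← map_sub, ← inner_sub_left, ← LinearMap.sub_apply, ← map_sub,
    ← mat_sub, sq, ← mul_assoc, ← norm_mat]
  exact (real_inner_le_norm _ _).trans
    (mul_le_mul_of_nonneg_right (norm_toEuclideanLin_apply_le_frobenius_norm _ x) (norm_nonneg x))

theorem mem_spectrum_iff_exists_eig_eq {A : SymMat n} {μ : ℝ} :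
    μ ∈ spectrum ℝ A.mat ↔ ∃ i, A.eig i = μ := by
  rw [A.isHermitian.spectrum_real_eq_range_eigenvalues, Set.mem_range]
  exact ((Fintype.equivOfCardEq (Fintype.card_fin _)).symm.surjective.exists
    (p := fun i => A.eig i = μ)).symm

section NormalCone

variable {X Γ : SymMat n}

theorem mem_normalCone_psdCone_iff : Γ ∈ normalCone (psdCone n) X ↔
    X.mat.PosSemidef ∧ (-Γ.mat).PosSemidef ∧ X.mat * Γ.mat = 0 := by
  refine ⟨fun ⟨hX, hpolar⟩ => ?_, fun ⟨hX, hΓ, hXΓ⟩ => ⟨hX, fun Y hY => ?_⟩⟩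
  · have hX : X.mat.PosSemidef := hX
    have hneg (Y : SymMat n) (hY : Y.mat.PosSemidef) : ⟪Γ, Y⟫ ≤ 0 := by
      simpa only [add_sub_cancel_left] using hpolar (X + Y) (hX.add hY)
    have hΓ : (-Γ.mat).PosSemidef := by
      refine .of_dotProduct_mulVec_nonneg Γ.isHermitian.neg fun y => ?_
      have hy := posSemidef_vecMulVec_self_star y
      have := hneg (ofMat _ hy.isHermitian) hy
      rw [inner_eq_trace, mat_ofMat, mul_vecMulVec, trace_vecMulVec, dotProduct_comm] at this
      rw [neg_mulVec, dotProduct_neg]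
      linarith
    have hXX : ⟪Γ, X⟫ = 0 := by
      have := hpolar 0 PosSemidef.zero
      rw [zero_sub, inner_neg_right] at this
      linarith [hneg X hX]
    refine ⟨hX, hΓ, neg_eq_zero.mp ?_⟩
    rw [← Matrix.mul_neg]
    refine mul_eq_zero_of_trace_mul_eq_zero hX hΓ ?_
    rw [Matrix.mul_neg, trace_neg, ← inner_eq_trace, real_inner_comm, hXX, neg_zero]
  · have htr := trace_mul_nonneg_of_posSemidef hΓ hY
    rw [Matrix.neg_mul, trace_neg, ← inner_eq_trace] at htr
    rw [inner_sub_right, real_inner_comm X Γ, inner_eq_trace X, hXΓ, trace_zero]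
    linarith

theorem mul_eq_zero_comm (hXΓ : X.mat * Γ.mat = 0) : Γ.mat * X.mat = 0 := by
  rw [← conjTranspose_eq_zero, conjTranspose_mul, conjTranspose_mat, conjTranspose_mat, hXΓ]

theorem mem_normalCone_nsdCone (hΓ : Γ ∈ normalCone (psdCone n) X) :
    X ∈ normalCone (nsdCone n) Γ := by
  obtain ⟨hX, hΓ, hXΓ⟩ := mem_normalCone_psdCone_iff.mp hΓ
  refine ⟨hΓ, fun Y hY => ?_⟩
  have htr := trace_mul_nonneg_of_posSemidef hX hY
  rw [Matrix.mul_neg, trace_neg, ← inner_eq_trace] at htr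
  rw [inner_sub_right, inner_eq_trace X Γ, hXΓ, trace_zero]
  linarith

theorem exists_mem_normalCone_psdCone_add_eq (A : SymMat n) :
    ∃ Z N : SymMat n, N ∈ normalCone (psdCone n) Z ∧ A = Z + N := by
  have hcont := continuousOn_real_spectrum A.mat
  refine ⟨ofMat _ (isHermitian_cfc (fun μ => max μ 0) A.mat),
    ofMat _ (isHermitian_cfc (fun μ => min μ 0) A.mat), mem_normalCone_psdCone_iff.mpr
      ⟨posSemidef_cfc fun μ _ => le_max_right μ 0, ?_, ?_⟩, mat_injective ?_⟩
  · rw [mat_ofMat, ← cfc_neg]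
    exact posSemidef_cfc fun μ _ => neg_nonneg.mpr (min_le_right μ 0)
  · rw [mat_ofMat, mat_ofMat, ← cfc_mul _ _ _ (hcont _) (hcont _)]
    simp only [max_mul_min, mul_zero, cfc_const_zero]
  · rw [mat_add, mat_ofMat, mat_ofMat, ← cfc_add _ _ _ (hcont _) (hcont _)]
    simp only [max_add_min, add_zero]
    exact (cfc_id' ℝ A.mat A.isHermitian.isSelfAdjoint).symm

end NormalCone

section PseudoInverse

/-- The Moore–Penrose inverse of a symmetric matrix, which inverts its nonzero eigenvalues. The
functional calculus gives exactly this because `0⁻¹ = 0` in `ℝ`. -/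
noncomputable def pinv (A : SymMat n) : SymMat n :=
  ofMat (cfc (fun μ : ℝ => μ⁻¹) A.mat) (isHermitian_cfc _ _)

/-- The orthogonal projection onto the kernel of a symmetric matrix. -/
noncomputable def kerProj (A : SymMat n) : Matrix (Fin n) (Fin n) ℝ :=
  1 - A.mat * A.pinv.mat

variable (A : SymMat n)

theorem cfc_id_mat : cfc (fun μ : ℝ => μ) A.mat = A.mat :=
  cfc_id' ℝ A.mat A.isHermitian.isSelfAdjoint

theorem mul_pinv_eq_cfc : A.mat * A.pinv.mat = cfc (fun μ : ℝ => μ * μ⁻¹) A.mat := by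
  have hcont := continuousOn_real_spectrum A.mat
  rw [cfc_mul _ _ _ (hcont _) (hcont _), cfc_id_mat, pinv, mat_ofMat]

theorem pinv_mul_eq_mul_pinv : A.pinv.mat * A.mat = A.mat * A.pinv.mat := by
  rw [mul_pinv_eq_cfc, ← (isHermitian_cfc _ _).eq, ← mul_pinv_eq_cfc, conjTranspose_mul,
    conjTranspose_mat, conjTranspose_mat]

theorem mul_pinv_mul : A.mat * A.pinv.mat * A.mat = A.mat := by
  have hcont := continuousOn_real_spectrum A.mat
  simpa only [mul_inv_mul_cancel, cfc_id_mat, ← mul_pinv_eq_cfc] using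
    (cfc_mul (fun μ : ℝ => μ * μ⁻¹) (fun μ => μ) A.mat (hcont _) (hcont _)).symm

theorem pinv_mul_pinv : A.pinv.mat * A.mat * A.pinv.mat = A.pinv.mat := by
  have hcont := continuousOn_real_spectrum A.mat
  have hinv (μ : ℝ) : μ⁻¹ * (μ * μ⁻¹) = μ⁻¹ := by
    simpa only [inv_inv, mul_assoc] using mul_inv_mul_cancel μ⁻¹
  rw [Matrix.mul_assoc, mul_pinv_eq_cfc, pinv, mat_ofMat, ← cfc_mul _ _ _ (hcont _) (hcont _)]
  simp only [hinv]

theorem kerProj_eq_cfc : A.kerProj = cfc (fun μ : ℝ => 1 - μ * μ⁻¹) A.mat := by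
  have hcont := continuousOn_real_spectrum A.mat
  rw [cfc_sub _ _ _ (hcont _) (hcont _), cfc_const_one ℝ A.mat A.isHermitian.isSelfAdjoint,
    ← mul_pinv_eq_cfc, kerProj]

theorem conjTranspose_kerProj : A.kerProjᴴ = A.kerProj := by
  rw [kerProj_eq_cfc, (isHermitian_cfc _ _).eq]

theorem kerProj_mul : A.kerProj * A.mat = 0 := by
  rw [kerProj, Matrix.sub_mul, mul_pinv_mul, Matrix.one_mul, sub_self]

theorem kerProj_mul_pinv : A.kerProj * A.pinv.mat = 0 := by
  rw [kerProj, Matrix.sub_mul, ← pinv_mul_eq_mul_pinv, pinv_mul_pinv, Matrix.one_mul, sub_self]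

theorem mul_kerProj : A.mat * A.kerProj = 0 := by
  rw [← conjTranspose_eq_zero, conjTranspose_mul, conjTranspose_mat, conjTranspose_kerProj,
    kerProj_mul]

theorem pinv_mul_kerProj : A.pinv.mat * A.kerProj = 0 := by
  rw [← conjTranspose_eq_zero, conjTranspose_mul, conjTranspose_mat, conjTranspose_kerProj,
    kerProj_mul_pinv]

theorem kerProj_mul_kerProj : A.kerProj * A.kerProj = A.kerProj := by
  nth_rw 2 [kerProj]
  rw [Matrix.mul_sub, Matrix.mul_one, ← Matrix.mul_assoc, kerProj_mul, Matrix.zero_mul, sub_zero]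

theorem posSemidef_pinv {A : SymMat n} (hA : A.mat.PosSemidef) : A.pinv.mat.PosSemidef :=
  posSemidef_cfc fun _ hμ =>
    inv_nonneg.mpr ((posSemidef_iff_isHermitian_and_spectrum_nonneg.mp hA).2 hμ)

theorem norm_mul_pinv_mul_le (M : Matrix (Fin n) (Fin n) ℝ) :
    ‖A.mat * A.pinv.mat * M‖ ≤ ‖M‖ := by
  rw [mul_pinv_eq_cfc, ← one_mul ‖M‖]
  refine frobenius_norm_cfc_mul_le A.isHermitian zero_le_one (fun μ _ => ?_) M
  rcases eq_or_ne μ 0 with rfl | hμ <;> simp [*]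

theorem norm_kerProj_mul_le (M : Matrix (Fin n) (Fin n) ℝ) : ‖A.kerProj * M‖ ≤ ‖M‖ := by
  rw [kerProj_eq_cfc, ← one_mul ‖M‖]
  refine frobenius_norm_cfc_mul_le A.isHermitian zero_le_one (fun μ _ => ?_) M
  rcases eq_or_ne μ 0 with rfl | hμ <;> simp [*]

theorem norm_mul_kerProj_le (M : Matrix (Fin n) (Fin n) ℝ) : ‖M * A.kerProj‖ ≤ ‖M‖ := by
  rw [← frobenius_norm_conjTranspose, conjTranspose_mul, conjTranspose_kerProj,
    ← frobenius_norm_conjTranspose M]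
  exact norm_kerProj_mul_le A _

variable {A} {κ : ℝ} (hκ : 0 ≤ κ) (hA : ∀ μ ∈ spectrum ℝ A.mat, |μ⁻¹| ≤ κ)
include hκ hA

theorem norm_pinv_mul_le (M : Matrix (Fin n) (Fin n) ℝ) : ‖A.pinv.mat * M‖ ≤ κ * ‖M‖ :=
  frobenius_norm_cfc_mul_le A.isHermitian hκ hA M

theorem norm_mul_pinv_le (M : Matrix (Fin n) (Fin n) ℝ) : ‖M * A.pinv.mat‖ ≤ κ * ‖M‖ :=
  frobenius_norm_mul_cfc_le A.isHermitian hκ hA M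

theorem norm_mul_pinv_mul_self_le (W : SymMat n) :
    ‖W.mat * A.pinv.mat * W.mat‖ ≤ κ * ‖W‖ ^ 2 := by
  calc ‖W.mat * A.pinv.mat * W.mat‖ ≤ ‖W.mat * A.pinv.mat‖ * ‖W.mat‖ := norm_mul_le _ _
    _ ≤ κ * ‖W.mat‖ * ‖W.mat‖ := by gcongr; exact norm_mul_pinv_le hκ hA _
    _ = κ * ‖W‖ ^ 2 := by rw [norm_mat]; ring

end PseudoInverse

section Gap

variable {X Γ : SymMat n}

theorem mem_spectrum_add_iff_of_mem_normalCone (hΓ : Γ ∈ normalCone (psdCone n) X) {μ : ℝ}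
    (hμ : μ ≠ 0) :
    μ ∈ spectrum ℝ (X + Γ).mat ↔ μ ∈ spectrum ℝ X.mat ∨ μ ∈ spectrum ℝ Γ.mat := by
  have hXΓ := (mem_normalCone_psdCone_iff.mp hΓ).2.2
  exact mem_spectrum_add_iff_of_mul_eq_zero hXΓ (mul_eq_zero_comm hXΓ) hμ

theorem nonpos_of_mem_spectrum_of_mem_normalCone (hΓ : Γ ∈ normalCone (psdCone n) X) {μ : ℝ}
    (hμ : μ ∈ spectrum ℝ Γ.mat) : μ ≤ 0 := by
  have hnsd := (mem_normalCone_psdCone_iff.mp hΓ).2.1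
  rw [← neg_nonneg]
  refine (posSemidef_iff_isHermitian_and_spectrum_nonneg.mp hnsd).2 ?_
  rwa [← spectrum.neg_eq, Set.neg_mem_neg]

theorem exists_pos_forall_le_abs_of_mem_spectrum (X A : SymMat n) {r : ℝ}
    (hneg : ∀ i, A.eig i < 0 → r < |A.eig i|) :
    ∃ c > 0, ∀ Γ ∈ normalCone (psdCone n) X, ‖X + Γ - A‖ ≤ r →
      {i | (X + Γ).eig i < 0} = {i | A.eig i < 0} →
      ∀ μ ∈ spectrum ℝ (X + Γ).mat, μ ≠ 0 → c ≤ |μ| := by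
  have hlower {y : ℝ} (hy : 0 < y) : ∀ᶠ c in 𝓝[>] (0 : ℝ), c ≤ y :=
    (eventually_le_nhds hy).filter_mono nhdsWithin_le_nhds
  have hpos : ∀ᶠ c in 𝓝[>] (0 : ℝ), ∀ μ ∈ spectrum ℝ X.mat, μ ≠ 0 → c ≤ |μ| :=
    (eventually_all_finite X.mat.finite_real_spectrum).mpr fun μ _ =>
      eventually_imp_distrib_left.mpr fun hμ => hlower (abs_pos.mpr hμ)
  have hnegA : ∀ᶠ c in 𝓝[>] (0 : ℝ), ∀ i, A.eig i < 0 → c ≤ |A.eig i| - r :=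
    eventually_all.mpr fun i =>
      eventually_imp_distrib_left.mpr fun hi => hlower (sub_pos.mpr (hneg i hi))
  obtain ⟨c, ⟨hcX, hcA⟩, hc⟩ := ((hpos.and hnegA).and self_mem_nhdsWithin).exists
  refine ⟨c, hc, fun Γ hΓ hr hsame μ hμ hμ0 => ?_⟩
  rcases (mem_spectrum_add_iff_of_mem_normalCone hΓ hμ0).mp hμ with hμX | hμΓ
  · exact hcX μ hμX hμ0
  obtain ⟨i, hi⟩ := mem_spectrum_iff_exists_eig_eq.mp hμ
  have hμneg : μ < 0 := (nonpos_of_mem_spectrum_of_mem_normalCone hΓ hμΓ).lt_of_ne hμ0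
  have hAi : A.eig i < 0 := hsame.subset (show (X + Γ).eig i < 0 by rwa [hi])
  have hweyl := eig_le_eig_add_norm_sub (X + Γ) A i
  have hgap := hcA i hAi
  rw [abs_of_neg hAi] at hgap
  rw [abs_of_neg hμneg]
  linarith

end Gap

section SecondOrder

variable {X Γ : SymMat n}

theorem kerProj_mul_eq_self (hXΓ : X.mat * Γ.mat = 0) : X.kerProj * Γ.mat = Γ.mat := by
  rw [kerProj, ← pinv_mul_eq_mul_pinv, Matrix.sub_mul, Matrix.mul_assoc, hXΓ, Matrix.mul_zero,
    Matrix.one_mul, sub_zero]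

theorem mul_kerProj_eq_self (hXΓ : X.mat * Γ.mat = 0) : Γ.mat * X.kerProj = Γ.mat := by
  rw [kerProj, Matrix.mul_sub, ← Matrix.mul_assoc, mul_eq_zero_comm hXΓ, Matrix.zero_mul,
    Matrix.mul_one, sub_zero]

/-- Half the second subderivative at `X` for `Γ` of the indicator function of the cone of positive
semidefinite matrices, on the critical cone: `-⟨Γ, W X⁺ W⟩`. It comes from the curvature of the
boundary of the cone. -/
noncomputable def curvature (X Γ W : SymMat n) : ℝ :=
  -(Γ.mat * (W.mat * X.pinv.mat * W.mat)).trace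

/-- The critical cone of the cone of positive semidefinite matrices at `X` for `Γ`: the tangent
directions at `X`, which are those `W` whose compression to the kernel of `X` is positive
semidefinite, that are orthogonal to `Γ`. -/
def criticalCone (X Γ : SymMat n) : Set (SymMat n) :=
  {W | (X.kerProj * W.mat * X.kerProj).PosSemidef ∧ ⟪Γ, W⟫ = 0}

/-- The second-order term that bends a tangent direction `W` at `X` into the cone of positive
semidefinite matrices. Conjugation by `(1 + X.kerProj) / 2` is chosen so that no smallness of `W`
is needed in `add_correction_mem_psdCone`. -/
noncomputable def correction (X W : SymMat n) : SymMat n :=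
  ofMat ((1 / 2 : ℝ) • (1 + X.kerProj) * (W.mat * X.pinv.mat * W.mat) *
    (1 / 2 : ℝ) • (1 + X.kerProj)) <| show IsHermitian _ by
      simp only [IsHermitian, conjTranspose_mul, conjTranspose_smul, conjTranspose_add,
        conjTranspose_one, conjTranspose_kerProj, conjTranspose_mat, star_trivial,
        Matrix.mul_assoc]

theorem mat_correction (X W : SymMat n) : (correction X W).mat =
    (1 / 2 : ℝ) • (1 + X.kerProj) * (W.mat * X.pinv.mat * W.mat) *
      (1 / 2 : ℝ) • (1 + X.kerProj) :=
  rfl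

theorem zero_mem_criticalCone : (0 : SymMat n) ∈ criticalCone X Γ := by
  refine ⟨?_, inner_zero_right _⟩
  rw [mat_zero, Matrix.mul_zero, Matrix.zero_mul]
  exact .zero

theorem curvature_smul (t : ℝ) (W : SymMat n) :
    curvature X Γ (t • W) = t ^ 2 * curvature X Γ W := by
  simp only [curvature, mat_smul, Matrix.smul_mul, Matrix.mul_smul, trace_smul, smul_eq_mul]
  ring

theorem correction_smul (t : ℝ) (W : SymMat n) :
    correction X (t • W) = t ^ 2 • correction X W :=
  mat_injective (by
    simp only [mat_correction, mat_smul, Matrix.smul_mul, Matrix.mul_smul, smul_smul]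
    module)

theorem curvature_nonneg (hX : X.mat.PosSemidef) (hΓ : (-Γ.mat).PosSemidef) (W : SymMat n) :
    0 ≤ curvature X Γ W := by
  have hWJW := (posSemidef_pinv hX).mul_mul_conjTranspose_same W.mat
  rw [conjTranspose_mat] at hWJW
  simpa only [curvature, Matrix.neg_mul, trace_neg] using trace_mul_nonneg_of_posSemidef hΓ hWJW

theorem add_correction_mem_psdCone (hX : X.mat.PosSemidef) {W : SymMat n}
    (hW : (X.kerProj * W.mat * X.kerProj).PosSemidef) : X + W + correction X W ∈ psdCone n := by
  set L := (1 / 2 : ℝ) • (1 + X.kerProj) with hL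
  have hLW : L * W.mat * (1 - X.kerProj) + (1 - X.kerProj) * W.mat * L
      + X.kerProj * W.mat * X.kerProj = W.mat := by
    rw [hL]
    simp only [Matrix.mul_sub, Matrix.sub_mul, Matrix.add_mul, Matrix.mul_add, Matrix.mul_one,
      Matrix.one_mul, Matrix.smul_mul, Matrix.mul_smul]
    module
  have hcongr : (1 + L * W.mat * X.pinv.mat) * X.mat * (1 + L * W.mat * X.pinv.mat)ᴴ =
      X.mat + (L * W.mat * (1 - X.kerProj) + (1 - X.kerProj) * W.mat * L) +
        (correction X W).mat := by
    have hLH : Lᴴ = L := by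
      rw [hL, conjTranspose_smul, conjTranspose_add, conjTranspose_one, conjTranspose_kerProj,
        star_trivial]
    have hexpand : (1 + L * W.mat * X.pinv.mat) * X.mat * (1 + X.pinv.mat * (W.mat * L)) =
        X.mat + (L * W.mat * (X.pinv.mat * X.mat) + X.mat * X.pinv.mat * W.mat * L) +
          L * (W.mat * (X.pinv.mat * X.mat * X.pinv.mat) * W.mat) * L := by noncomm_ring
    rw [conjTranspose_add, conjTranspose_mul, conjTranspose_mul, hLH, conjTranspose_one,
      conjTranspose_mat, conjTranspose_mat, hexpand, pinv_mul_pinv, pinv_mul_eq_mul_pinv,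
      mat_correction, ← hL, show 1 - X.kerProj = X.mat * X.pinv.mat from sub_sub_cancel _ _]
  have hsum := (hX.mul_mul_conjTranspose_same (1 + L * W.mat * X.pinv.mat)).add hW
  have hdecomp : (X + W + correction X W).mat =
      (1 + L * W.mat * X.pinv.mat) * X.mat * (1 + L * W.mat * X.pinv.mat)ᴴ
        + X.kerProj * W.mat * X.kerProj := by
    rw [hcongr, mat_add, mat_add]
    nth_rw 1 [← hLW]
    abel
  change PosSemidef _
  rwa [hdecomp]

theorem norm_correction_le {κ : ℝ} (hκ : 0 ≤ κ) (hX : ∀ μ ∈ spectrum ℝ X.mat, |μ⁻¹| ≤ κ)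
    (W : SymMat n) : ‖correction X W‖ ≤ κ * ‖W‖ ^ 2 := by
  have hleft (M : Matrix (Fin n) (Fin n) ℝ) : ‖(1 / 2 : ℝ) • (1 + X.kerProj) * M‖ ≤ ‖M‖ := by
    rw [Matrix.smul_mul, Matrix.add_mul, Matrix.one_mul, norm_smul,
      Real.norm_of_nonneg one_half_pos.le]
    linarith [norm_add_le M (X.kerProj * M), norm_kerProj_mul_le X M]
  have hright (M : Matrix (Fin n) (Fin n) ℝ) : ‖M * (1 / 2 : ℝ) • (1 + X.kerProj)‖ ≤ ‖M‖ := by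
    rw [Matrix.mul_smul, Matrix.mul_add, Matrix.mul_one, norm_smul,
      Real.norm_of_nonneg one_half_pos.le]
    linarith [norm_add_le M (M * X.kerProj), norm_mul_kerProj_le X M]
  rw [← norm_mat, mat_correction]
  exact (hright _).trans ((hleft _).trans (norm_mul_pinv_mul_self_le hκ hX W))

theorem inner_correction (hXΓ : X.mat * Γ.mat = 0) (W : SymMat n) :
    ⟪Γ, correction X W⟫ = -curvature X Γ W := by
  have hΓL : Γ.mat * (1 / 2 : ℝ) • (1 + X.kerProj) = Γ.mat := by
    rw [Matrix.mul_smul, Matrix.mul_add, mul_kerProj_eq_self hXΓ, Matrix.mul_one]; module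
  have hLΓ : (1 / 2 : ℝ) • (1 + X.kerProj) * Γ.mat = Γ.mat := by
    rw [Matrix.smul_mul, Matrix.add_mul, kerProj_mul_eq_self hXΓ, Matrix.one_mul]; module
  rw [inner_eq_trace, mat_correction, ← Matrix.mul_assoc, trace_mul_comm,
    ← Matrix.mul_assoc, ← Matrix.mul_assoc, hLΓ, hΓL, curvature, neg_neg]

theorem inner_nonpos_of_posSemidef_kerProj (hΓ : Γ ∈ normalCone (psdCone n) X) {W : SymMat n}
    (hW : (X.kerProj * W.mat * X.kerProj).PosSemidef) : ⟪Γ, W⟫ ≤ 0 := by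
  obtain ⟨-, hnsd, hXΓ⟩ := mem_normalCone_psdCone_iff.mp hΓ
  have htr := trace_mul_nonneg_of_posSemidef hnsd hW
  rw [Matrix.neg_mul, trace_neg, ← Matrix.mul_assoc, ← Matrix.mul_assoc, trace_mul_comm,
    ← Matrix.mul_assoc, ← Matrix.mul_assoc, kerProj_mul_eq_self hXΓ, mul_kerProj_eq_self hXΓ,
    ← inner_eq_trace] at htr
  linarith

theorem posSemidef_kerProj_mul_mul_kerProj {W : SymMat n} (hXW : X + W ∈ psdCone n) :
    (X.kerProj * W.mat * X.kerProj).PosSemidef := by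
  have := PosSemidef.mul_mul_conjTranspose_same hXW X.kerProj
  rwa [mat_add, Matrix.mul_add, kerProj_mul, zero_add, conjTranspose_kerProj] at this

theorem curvature_add_trace_le (hΓ : Γ ∈ normalCone (psdCone n) X) {W : SymMat n}
    (hXW : X + W ∈ psdCone n) : curvature X Γ W +
      (X.pinv.mat * W.mat * Γ.mat * (W.mat * X.pinv.mat * W.mat)).trace ≤ -⟪Γ, W⟫ := by
  obtain ⟨-, hnsd, hXΓ⟩ := mem_normalCone_psdCone_iff.mp hΓ
  have hpsd := PosSemidef.mul_mul_conjTranspose_same hXW (1 - W.mat * X.pinv.mat)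
  have hexpand : (1 - W.mat * X.pinv.mat) * (X.mat + W.mat) * (1 - X.pinv.mat * W.mat) =
      X.mat * (1 - X.pinv.mat * W.mat) + W.mat - W.mat * X.pinv.mat * X.mat
        - W.mat * X.pinv.mat * W.mat
        + (W.mat * (X.pinv.mat * X.mat * X.pinv.mat) * W.mat - W.mat * X.pinv.mat * W.mat)
        + W.mat * X.pinv.mat * W.mat * (X.pinv.mat * W.mat) := by
    noncomm_ring
  have hleft : (Γ.mat * (X.mat * (1 - X.pinv.mat * W.mat))).trace = 0 := by
    rw [← Matrix.mul_assoc, mul_eq_zero_comm hXΓ, Matrix.zero_mul, trace_zero]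
  have hright : (Γ.mat * (W.mat * X.pinv.mat * X.mat)).trace = 0 := by
    rw [← Matrix.mul_assoc, trace_mul_comm, ← Matrix.mul_assoc, hXΓ, Matrix.zero_mul, trace_zero]
  have hcubic : (Γ.mat * (W.mat * X.pinv.mat * W.mat * (X.pinv.mat * W.mat))).trace =
      (X.pinv.mat * W.mat * Γ.mat * (W.mat * X.pinv.mat * W.mat)).trace := by
    rw [← Matrix.mul_assoc, trace_mul_comm, ← Matrix.mul_assoc]
  rw [conjTranspose_sub, conjTranspose_mul, conjTranspose_mat, conjTranspose_mat,
    conjTranspose_one, mat_add, hexpand, pinv_mul_pinv, sub_self, add_zero] at hpsd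
  have htr := trace_mul_nonneg_of_posSemidef hnsd hpsd
  rw [Matrix.neg_mul, trace_neg, Matrix.mul_add, Matrix.mul_sub, Matrix.mul_sub, Matrix.mul_add,
    trace_add, trace_sub, trace_sub, trace_add, hleft, hright, hcubic] at htr
  rw [curvature, inner_eq_trace]
  linarith

end SecondOrder

section SecondSubderivative

variable {X Γ : SymMat n} (hΓ : Γ ∈ normalCone (psdCone n) X)
include hΓ

theorem secondSubderiv_convIndicator_psdCone_le {W : SymMat n} (hW : W ∈ criticalCone X Γ) :
    secondSubderiv (convIndicator (psdCone n)) X Γ W ≤ ((2 * curvature X Γ W : ℝ) : EReal) := by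
  obtain ⟨hX, -, hXΓ⟩ := mem_normalCone_psdCone_iff.mp hΓ
  have hpath : Tendsto (fun t : ℝ => W + t • correction X W) (𝓝[>] 0) (𝓝 W) := by
    have hcont : Continuous fun t : ℝ => W + t • correction X W := by fun_prop
    simpa only [zero_smul, add_zero] using (hcont.tendsto 0).mono_left nhdsWithin_le_nhds
  refine secondSubderiv_convIndicator_le_of_tendsto hΓ.1 hpath ?_
  filter_upwards [self_mem_nhdsWithin] with t (ht : 0 < t)
  refine ⟨?_, ?_⟩
  · have htW : (X.kerProj * (t • W).mat * X.kerProj).PosSemidef := by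
      rw [mat_smul, Matrix.mul_smul, Matrix.smul_mul]
      exact hW.1.smul ht.le
    have hmem := add_correction_mem_psdCone hX htW
    rwa [correction_smul, sq, mul_smul, add_assoc, ← smul_add] at hmem
  · rw [inner_add_right, hW.2, inner_smul_right, inner_correction hXΓ]
    linarith

theorem posSemidef_and_curvature_le_of_add_smul_mem {c t : ℝ} (ht : 0 < t) {W : SymMat n}
    (hmem : X + t • W ∈ psdCone n) (hle : -(2 * ⟪Γ, W⟫) ≤ c * t) :
    (X.kerProj * W.mat * X.kerProj).PosSemidef ∧ 2 * curvature X Γ W +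
      2 * t * (X.pinv.mat * W.mat * Γ.mat * (W.mat * X.pinv.mat * W.mat)).trace ≤ c := by
  refine ⟨?_, ?_⟩
  · have htW := (posSemidef_kerProj_mul_mul_kerProj hmem).smul (inv_nonneg.mpr ht.le)
    rwa [mat_smul, Matrix.mul_smul, Matrix.smul_mul, inv_smul_smul₀ ht.ne'] at htW
  · have hcurv := curvature_add_trace_le hΓ hmem
    simp only [curvature_smul, mat_smul, Matrix.smul_mul, Matrix.mul_smul, trace_smul,
      smul_eq_mul, inner_smul_right] at hcurv
    refine le_of_mul_le_mul_left ?_ (pow_pos ht 2)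
    linarith [mul_le_mul_of_nonneg_left hle ht.le]

theorem mem_criticalCone_of_secondSubderiv_lt {c : ℝ} {W : SymMat n}
    (hlt : secondSubderiv (convIndicator (psdCone n)) X Γ W < (c : EReal)) :
    W ∈ criticalCone X Γ ∧ 2 * curvature X Γ W ≤ c := by
  have hfreq := frequently_of_secondSubderiv_convIndicator_lt hΓ.1 hlt
  have hnhds : 𝓝[>] (0 : ℝ) ×ˢ 𝓝 W ≤ 𝓝 ((0 : ℝ), W) := by
    rw [nhds_prod_eq]
    exact Filter.prod_mono nhdsWithin_le_nhds le_rfl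
  have hmat : Continuous fun p : ℝ × SymMat n => p.2.mat := continuous_mat.comp continuous_snd
  have htangent : (X.kerProj * W.mat * X.kerProj).PosSemidef := by
    have hcont : Continuous fun p : ℝ × SymMat n => X.kerProj * p.2.mat * X.kerProj := by fun_prop
    exact isClosed_setOf_posSemidef.mem_of_frequently_of_tendsto
      (hfreq.mono fun p ⟨hp, hmem, hle⟩ =>
        (posSemidef_and_curvature_le_of_add_smul_mem hΓ hp hmem hle).1)
      ((hcont.tendsto _).mono_left hnhds)
  refine ⟨⟨htangent, (inner_nonpos_of_posSemidef_kerProj hΓ htangent).antisymm ?_⟩, ?_⟩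
  · have hcont : Continuous fun p : ℝ × SymMat n => -(2 * ⟪Γ, p.2⟫) - c * p.1 := by fun_prop
    have hlim := le_of_tendsto_of_frequently ((hcont.tendsto _).mono_left hnhds)
      (hfreq.mono fun p hp => sub_nonpos.mpr hp.2.2)
    linarith
  · have hcont : Continuous fun p : ℝ × SymMat n => 2 * curvature X Γ p.2 + 2 * p.1 *
        (X.pinv.mat * p.2.mat * Γ.mat * (p.2.mat * X.pinv.mat * p.2.mat)).trace := by
      unfold curvature
      fun_prop
    have hlim := le_of_tendsto_of_frequently ((hcont.tendsto _).mono_left hnhds)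
      (hfreq.mono fun p ⟨hp, hmem, hle⟩ =>
        (posSemidef_and_curvature_le_of_add_smul_mem hΓ hp hmem hle).2)
    simpa only [mul_zero, zero_mul, add_zero] using hlim

open Classical in
theorem secondSubderiv_convIndicator_psdCone (W : SymMat n) :
    secondSubderiv (convIndicator (psdCone n)) X Γ W =
      if W ∈ criticalCone X Γ then ((2 * curvature X Γ W : ℝ) : EReal) else ⊤ := by
  refine le_antisymm ?_ (le_of_not_gt fun hlt => ?_)
  · split_ifs with hW
    · exact secondSubderiv_convIndicator_psdCone_le hΓ hW
    · exact le_top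
  · obtain ⟨c, hc, hc'⟩ := EReal.lt_iff_exists_real_btwn.mp hlt
    obtain ⟨hW, hcurv⟩ := mem_criticalCone_of_secondSubderiv_lt hΓ hc
    rw [if_pos hW, EReal.coe_lt_coe_iff] at hc'
    exact hcurv.not_gt hc'

theorem coe_le_moreauEnv_secondSubderiv_iff {H : SymMat n} {v : ℝ} :
    (v : EReal) ≤ moreauEnv (1 / 2) (secondSubderiv (convIndicator (psdCone n)) X Γ) H ↔
      ∀ W ∈ criticalCone X Γ, v ≤ 2 * curvature X Γ W + ‖W - H‖ ^ 2 := by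
  rw [moreauEnv, le_iInf_iff]
  refine forall_congr' fun W => ?_
  rw [secondSubderiv_convIndicator_psdCone hΓ, mul_one_div_cancel two_ne_zero, div_one, one_mul]
  split_ifs with hW
  · rw [← EReal.coe_add, EReal.coe_le_coe_iff, forall_prop_of_true hW]
  · simp only [EReal.top_add_coe, le_top, hW, false_imp_iff]

theorem exists_moreauEnv_secondSubderiv_eq_coe (H : SymMat n) :
    ∃ q : ℝ, moreauEnv (1 / 2) (secondSubderiv (convIndicator (psdCone n)) X Γ) H = (q : EReal) ∧
      IsGLB ((fun W => 2 * curvature X Γ W + ‖W - H‖ ^ 2) '' criticalCone X Γ) q := by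
  obtain ⟨hX, hnsd, -⟩ := mem_normalCone_psdCone_iff.mp hΓ
  set E := moreauEnv (1 / 2) (secondSubderiv (convIndicator (psdCone n)) X Γ) H with hE
  have hbot : E ≠ ⊥ := by
    have hnonneg : ((0 : ℝ) : EReal) ≤ E := (coe_le_moreauEnv_secondSubderiv_iff hΓ).mpr
      fun W _ => by linarith [curvature_nonneg hX hnsd W, sq_nonneg ‖W - H‖]
    exact fun h => absurd (h ▸ hnonneg) (EReal.bot_lt_coe 0).not_ge
  have htop : E ≠ ⊤ := fun h => by
    have hle (v : ℝ) : (v : EReal) ≤ E := h ▸ le_top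
    exact (lt_add_one _).not_ge
      ((coe_le_moreauEnv_secondSubderiv_iff hΓ).mp (hle _) 0 zero_mem_criticalCone)
  lift E to ℝ using ⟨htop, hbot⟩ with q hq
  refine ⟨q, rfl, ?_, fun v hv => ?_⟩
  · rintro _ ⟨W, hW, rfl⟩
    exact (coe_le_moreauEnv_secondSubderiv_iff hΓ).mp (hE ▸ le_rfl) W hW
  · rw [← EReal.coe_le_coe_iff, hE, coe_le_moreauEnv_secondSubderiv_iff hΓ]
    exact fun W hW => hv ⟨W, hW, rfl⟩

end SecondSubderivative

section Transfer

variable {X Γ : SymMat n}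

/-- The element of the critical cone obtained from a feasible direction `W` by replacing its
compression `X.kerProj * W * X.kerProj` by the compression to the common kernel of `X` and `Γ`. -/
noncomputable def criticalPart (X Γ W : SymMat n) : SymMat n :=
  ofMat (W.mat - X.kerProj * (W.mat - Γ.kerProj * W.mat * Γ.kerProj) * X.kerProj) <|
    show IsHermitian _ by
      simp only [IsHermitian, conjTranspose_sub, conjTranspose_mul, conjTranspose_kerProj,
        conjTranspose_mat, Matrix.mul_assoc]

theorem mat_criticalPart (X Γ W : SymMat n) : (criticalPart X Γ W).mat =
    W.mat - X.kerProj * (W.mat - Γ.kerProj * W.mat * Γ.kerProj) * X.kerProj :=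
  rfl

theorem kerProj_mul_kerProj_comm (hXΓ : X.mat * Γ.mat = 0) :
    X.kerProj * Γ.kerProj = Γ.kerProj * X.kerProj := by
  have hΓ : Γ.kerProj = 1 - Γ.mat * Γ.pinv.mat := rfl
  rw [hΓ, Matrix.mul_sub, Matrix.sub_mul, ← Matrix.mul_assoc, kerProj_mul_eq_self hXΓ,
    ← pinv_mul_eq_mul_pinv Γ, Matrix.mul_assoc, mul_kerProj_eq_self hXΓ, Matrix.mul_one,
    Matrix.one_mul]

theorem curvature_criticalPart (W : SymMat n) :
    curvature X Γ (criticalPart X Γ W) = curvature X Γ W := by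
  have hright : X.pinv.mat * (criticalPart X Γ W).mat = X.pinv.mat * W.mat := by
    rw [mat_criticalPart, Matrix.mul_sub, ← Matrix.mul_assoc, ← Matrix.mul_assoc,
      pinv_mul_kerProj, Matrix.zero_mul, Matrix.zero_mul, sub_zero]
  have hleft : (criticalPart X Γ W).mat * X.pinv.mat = W.mat * X.pinv.mat := by
    rw [mat_criticalPart, Matrix.sub_mul, Matrix.mul_assoc _ X.kerProj, kerProj_mul_pinv,
      Matrix.mul_zero, sub_zero]
  rw [curvature, curvature, hleft, Matrix.mul_assoc W.mat, hright, ← Matrix.mul_assoc W.mat]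

theorem criticalPart_mem_criticalCone (hXΓ : X.mat * Γ.mat = 0) {W : SymMat n}
    (hXW : X + W ∈ psdCone n) : criticalPart X Γ W ∈ criticalCone X Γ := by
  refine ⟨?_, ?_⟩
  · have hcompress : X.kerProj * (criticalPart X Γ W).mat * X.kerProj =
        Γ.kerProj * (X.kerProj * W.mat * X.kerProj) * Γ.kerProj := by
      have hexpand (Q T M : Matrix (Fin n) (Fin n) ℝ) :
          Q * (M - Q * (M - T * M * T) * Q) * Q =
            Q * M * Q - Q * Q * M * (Q * Q) + Q * Q * T * M * (T * (Q * Q)) := by noncomm_ring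
      rw [mat_criticalPart, hexpand, kerProj_mul_kerProj, sub_self, zero_add,
        kerProj_mul_kerProj_comm hXΓ]
      nth_rw 2 [← kerProj_mul_kerProj_comm hXΓ]
      simp only [Matrix.mul_assoc]
    have hpsd := (posSemidef_kerProj_mul_mul_kerProj hXW).mul_mul_conjTranspose_same Γ.kerProj
    rwa [conjTranspose_kerProj, ← hcompress] at hpsd
  · have hΓW : (Γ.mat * (X.kerProj * (W.mat - Γ.kerProj * W.mat * Γ.kerProj) * X.kerProj)).trace =
        (Γ.mat * W.mat).trace := by
      rw [← Matrix.mul_assoc, ← Matrix.mul_assoc, mul_kerProj_eq_self hXΓ, trace_mul_comm,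
        ← Matrix.mul_assoc, kerProj_mul_eq_self hXΓ, Matrix.mul_sub, ← Matrix.mul_assoc,
        ← Matrix.mul_assoc, mul_kerProj, Matrix.zero_mul, Matrix.zero_mul, sub_zero]
    rw [inner_eq_trace, mat_criticalPart, Matrix.mul_sub, trace_sub, hΓW, sub_self]

theorem norm_sub_criticalPart_le {κ : ℝ} (hκ : 0 ≤ κ)
    (hΓ : ∀ μ ∈ spectrum ℝ Γ.mat, |μ⁻¹| ≤ κ) (hXΓ : X.mat * Γ.mat = 0) (W : SymMat n) :
    ‖W - criticalPart X Γ W‖ ≤ 2 * κ * ‖X.kerProj * W.mat * Γ.mat‖ := by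
  have hdecomp : (W - criticalPart X Γ W).mat =
      X.kerProj * W.mat * Γ.mat * Γ.pinv.mat +
        Γ.pinv.mat * (Γ.mat * W.mat * X.kerProj) * Γ.kerProj := by
    have hexpand (Q T M : Matrix (Fin n) (Fin n) ℝ) :
        Q * (M - T * M * T) * Q = Q * M * ((1 - T) * Q) + Q * (1 - T) * M * (T * Q) := by
      noncomm_ring
    have hrange : 1 - Γ.kerProj = Γ.mat * Γ.pinv.mat := sub_sub_cancel _ _
    rw [mat_sub, mat_criticalPart, sub_sub_cancel, hexpand, ← kerProj_mul_kerProj_comm hXΓ, hrange,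
      ← Matrix.mul_assoc X.kerProj Γ.mat, kerProj_mul_eq_self hXΓ, ← pinv_mul_eq_mul_pinv Γ,
      Matrix.mul_assoc Γ.pinv.mat, mul_kerProj_eq_self hXΓ, pinv_mul_eq_mul_pinv Γ]
    nth_rw 2 [← pinv_mul_eq_mul_pinv Γ]
    simp only [Matrix.mul_assoc]
  have hsymm : ‖Γ.mat * W.mat * X.kerProj‖ = ‖X.kerProj * W.mat * Γ.mat‖ := by
    rw [← frobenius_norm_conjTranspose, conjTranspose_mul, conjTranspose_mul,
      conjTranspose_kerProj, conjTranspose_mat, conjTranspose_mat, Matrix.mul_assoc]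
  rw [← norm_mat, hdecomp]
  calc _ ≤ ‖X.kerProj * W.mat * Γ.mat * Γ.pinv.mat‖ +
        ‖Γ.pinv.mat * (Γ.mat * W.mat * X.kerProj) * Γ.kerProj‖ := norm_add_le _ _
    _ ≤ κ * ‖X.kerProj * W.mat * Γ.mat‖ + κ * ‖Γ.mat * W.mat * X.kerProj‖ :=
        add_le_add (norm_mul_pinv_le hκ hΓ _)
          ((norm_mul_kerProj_le _ _).trans (norm_pinv_mul_le hκ hΓ _))
    _ = _ := by rw [hsymm]; ring

variable {W H : SymMat n}

theorem add_mul_add_sub_eq_zero (hN : Γ + H - W ∈ normalCone (psdCone n) (X + W)) :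
    (X.mat + W.mat) * Γ.mat = -((X.mat + W.mat) * (H - W).mat) := by
  have hzero := (mem_normalCone_psdCone_iff.mp hN).2.2
  rwa [add_sub_assoc, mat_add, mat_add, Matrix.mul_add, add_eq_zero_iff_eq_neg] at hzero

theorem norm_kerProj_mul_mul_le (hN : Γ + H - W ∈ normalCone (psdCone n) (X + W)) :
    ‖X.kerProj * W.mat * Γ.mat‖ ≤ ‖W‖ * ‖H - W‖ := by
  have heq : X.kerProj * W.mat * Γ.mat = -(X.kerProj * (W.mat * (H - W).mat)) := by
    have := congrArg (X.kerProj * ·) (add_mul_add_sub_eq_zero hN)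
    simpa only [Matrix.mul_neg, ← Matrix.mul_assoc, Matrix.mul_add, kerProj_mul, zero_add]
      using this
  rw [heq, norm_neg, ← norm_mat W, ← norm_mat (H - W)]
  exact (norm_kerProj_mul_le _ _).trans (norm_mul_le _ _)

theorem norm_pinv_mul_mul_le {κ : ℝ} (hκ : 0 ≤ κ) (hX : ∀ μ ∈ spectrum ℝ X.mat, |μ⁻¹| ≤ κ)
    (hXΓ : X.mat * Γ.mat = 0) (hN : Γ + H - W ∈ normalCone (psdCone n) (X + W)) :
    ‖X.pinv.mat * W.mat * Γ.mat‖ ≤ (1 + κ * ‖W‖) * ‖H - W‖ := by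
  have heq : X.pinv.mat * W.mat * Γ.mat =
      -(X.mat * X.pinv.mat * (H - W).mat + X.pinv.mat * W.mat * (H - W).mat) := by
    have := congrArg (X.pinv.mat * ·) (add_mul_add_sub_eq_zero hN)
    rw [Matrix.add_mul, hXΓ, zero_add] at this
    simpa only [Matrix.mul_neg, ← Matrix.mul_assoc, Matrix.mul_add, pinv_mul_eq_mul_pinv,
      Matrix.add_mul] using this
  rw [heq, norm_neg, ← norm_mat W, ← norm_mat (H - W), add_mul, one_mul]
  refine (norm_add_le _ _).trans (add_le_add (norm_mul_pinv_mul_le _ _) ?_)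
  exact (norm_mul_le _ _).trans
    (mul_le_mul_of_nonneg_right (norm_pinv_mul_le hκ hX _) (norm_nonneg _))

theorem norm_sq_add_norm_sub_sq_le (hΓ : Γ ∈ normalCone (psdCone n) X)
    (hN : Γ + H - W ∈ normalCone (psdCone n) (X + W)) : ‖W‖ ^ 2 + ‖W - H‖ ^ 2 ≤ ‖H‖ ^ 2 := by
  simpa only [add_sub_cancel_left] using
    norm_sq_add_norm_sq_le_of_add_eq_add (h := H) hΓ hN (by abel)

theorem norm_sub_sq_sub_inner_le (hN : Γ + H - W ∈ normalCone (psdCone n) (X + W)) {V : SymMat n}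
    (hV : X + V ∈ psdCone n) : ‖W - H‖ ^ 2 - 2 * ⟪Γ, W⟫ ≤ ‖V - H‖ ^ 2 - 2 * ⟪Γ, V⟫ := by
  have hmin := norm_sq_sub_inner_le_of_mem_normalCone (x := X) (v := Γ) (h := H) hN (by abel) hV
  rwa [add_sub_cancel_left, add_sub_cancel_left] at hmin

theorem norm_sub_sq_sub_inner_mem_Icc (hΓ : Γ ∈ normalCone (psdCone n) X)
    (hN : Γ + H - W ∈ normalCone (psdCone n) (X + W)) :
    ‖W - H‖ ^ 2 - 2 * ⟪Γ, W⟫ ∈ Set.Icc 0 (‖H‖ ^ 2) := by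
  have hpolar := hΓ.2 _ hN.1
  have hzero := norm_sub_sq_sub_inner_le hN (V := 0) (by rw [add_zero]; exact hΓ.1)
  rw [add_sub_cancel_left] at hpolar
  rw [zero_sub, norm_neg, inner_zero_right, mul_zero, sub_zero] at hzero
  exact ⟨by linarith [sq_nonneg ‖W - H‖], hzero⟩

theorem isGLB_mem_Icc (hΓ : Γ ∈ normalCone (psdCone n) X) {q : ℝ}
    (hq : IsGLB ((fun V => 2 * curvature X Γ V + ‖V - H‖ ^ 2) '' criticalCone X Γ) q) :
    q ∈ Set.Icc 0 (‖H‖ ^ 2) := by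
  obtain ⟨hX, hnsd, -⟩ := mem_normalCone_psdCone_iff.mp hΓ
  refine ⟨hq.2 ?_, ?_⟩
  · rintro _ ⟨V, -, rfl⟩
    linarith [curvature_nonneg hX hnsd V, sq_nonneg ‖V - H‖]
  · have hle := hq.1 ⟨0, zero_mem_criticalCone, rfl⟩
    simpa only [curvature, mat_zero, Matrix.zero_mul, Matrix.mul_zero, trace_zero, neg_zero,
      mul_zero, zero_add, zero_sub, norm_neg] using hle

variable {κ : ℝ}

theorem norm_sub_sq_sub_inner_le_of_mem_criticalCone (hκ : 0 ≤ κ)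
    (hX : ∀ μ ∈ spectrum ℝ X.mat, |μ⁻¹| ≤ κ) (hΓ : Γ ∈ normalCone (psdCone n) X)
    (hN : Γ + H - W ∈ normalCone (psdCone n) (X + W)) {V : SymMat n} (hV : V ∈ criticalCone X Γ) :
    ‖W - H‖ ^ 2 - 2 * ⟪Γ, W⟫ ≤
      2 * curvature X Γ V + ‖V - H‖ ^ 2 + 8 * κ * ‖H‖ ^ 3 + 16 * κ ^ 2 * ‖H‖ ^ 4 := by
  obtain ⟨hXpsd, hnsd, hXΓ⟩ := mem_normalCone_psdCone_iff.mp hΓ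
  rcases le_total (‖H‖ ^ 2) (2 * curvature X Γ V + ‖V - H‖ ^ 2) with hlarge | hsmall
  · have hle := (norm_sub_sq_sub_inner_mem_Icc hΓ hN).2
    have : 0 ≤ 8 * κ * ‖H‖ ^ 3 + 16 * κ ^ 2 * ‖H‖ ^ 4 := by positivity
    linarith
  · have hVH : ‖V - H‖ ≤ ‖H‖ := by
      refine le_of_sq_le_sq ?_ (norm_nonneg H)
      linarith [curvature_nonneg hXpsd hnsd V]
    have hVnorm : ‖V‖ ≤ 2 * ‖H‖ := by
      linarith [norm_le_norm_sub_add V H]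
    have hcorr : ‖correction X V‖ ≤ κ * (2 * ‖H‖) ^ 2 :=
      (norm_correction_le hκ hX V).trans (by gcongr)
    have hfeas := norm_sub_sq_sub_inner_le hN (V := V + correction X V)
      (by simpa only [add_assoc] using add_correction_mem_psdCone hXpsd hV.1)
    rw [inner_add_right, hV.2, inner_correction hXΓ, add_sub_right_comm] at hfeas
    linarith [norm_add_sq_le_of_norm_le hVH hcorr]

theorem curvature_le_of_mem_normalCone (hκ : 0 ≤ κ) (hX : ∀ μ ∈ spectrum ℝ X.mat, |μ⁻¹| ≤ κ)
    (hΓ : Γ ∈ normalCone (psdCone n) X) (hN : Γ + H - W ∈ normalCone (psdCone n) (X + W)) :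
    curvature X Γ W ≤ -⟪Γ, W⟫ + κ * ‖H‖ ^ 3 + κ ^ 2 * ‖H‖ ^ 4 := by
  have hnorm := norm_sq_add_norm_sub_sq_le hΓ hN
  have hW : ‖W‖ ≤ ‖H‖ := by
    refine le_of_sq_le_sq ?_ (norm_nonneg H)
    linarith [sq_nonneg ‖W - H‖]
  have hD : ‖H - W‖ ≤ ‖H‖ := by
    rw [norm_sub_rev]
    refine le_of_sq_le_sq ?_ (norm_nonneg H)
    linarith [sq_nonneg ‖W‖]
  have hfirst : ‖X.pinv.mat * W.mat * Γ.mat‖ ≤ (1 + κ * ‖H‖) * ‖H‖ :=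
    (norm_pinv_mul_mul_le hκ hX (mem_normalCone_psdCone_iff.mp hΓ).2.2 hN).trans (by gcongr)
  have hsecond : ‖W.mat * X.pinv.mat * W.mat‖ ≤ κ * ‖H‖ ^ 2 :=
    (norm_mul_pinv_mul_self_le hκ hX W).trans (by gcongr)
  have htrace := (abs_trace_mul_le_frobenius_norm_mul (X.pinv.mat * W.mat * Γ.mat)
    (W.mat * X.pinv.mat * W.mat)).trans (mul_le_mul hfirst hsecond (norm_nonneg _) (by positivity))
  linarith [curvature_add_trace_le hΓ hN.1, (abs_le.mp htrace).1]

theorem norm_criticalPart_sub_sq_le (hκ : 0 ≤ κ) (hΓspec : ∀ μ ∈ spectrum ℝ Γ.mat, |μ⁻¹| ≤ κ)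
    (hΓ : Γ ∈ normalCone (psdCone n) X) (hN : Γ + H - W ∈ normalCone (psdCone n) (X + W)) :
    ‖criticalPart X Γ W - H‖ ^ 2 ≤ ‖W - H‖ ^ 2 + 2 * κ * ‖H‖ ^ 3 + κ ^ 2 * ‖H‖ ^ 4 := by
  have hnorm := norm_sq_add_norm_sub_sq_le hΓ hN
  have hD : ‖W - H‖ ≤ ‖H‖ := by
    refine le_of_sq_le_sq ?_ (norm_nonneg H)
    linarith [sq_nonneg ‖W‖]
  have hprod : 2 * (‖W‖ * ‖H - W‖) ≤ ‖H‖ ^ 2 := by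
    rw [norm_sub_rev]
    linarith [two_mul_le_add_sq ‖W‖ ‖W - H‖]
  have hpart : ‖criticalPart X Γ W - W‖ ≤ κ * ‖H‖ ^ 2 := by
    rw [norm_sub_rev]
    calc _ ≤ 2 * κ * ‖X.kerProj * W.mat * Γ.mat‖ :=
          norm_sub_criticalPart_le hκ hΓspec (mem_normalCone_psdCone_iff.mp hΓ).2.2 W
      _ ≤ 2 * κ * (‖W‖ * ‖H - W‖) := by gcongr; exact norm_kerProj_mul_mul_le hN
      _ = κ * (2 * (‖W‖ * ‖H - W‖)) := by ring
      _ ≤ κ * ‖H‖ ^ 2 := by gcongr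
  rw [← sub_add_sub_cancel' W H (criticalPart X Γ W)]
  linarith [norm_add_sq_le_of_norm_le hD hpart]

theorem abs_norm_sub_sq_sub_inner_sub_le (hκ : 0 ≤ κ) (hX : ∀ μ ∈ spectrum ℝ X.mat, |μ⁻¹| ≤ κ)
    (hΓspec : ∀ μ ∈ spectrum ℝ Γ.mat, |μ⁻¹| ≤ κ) (hΓ : Γ ∈ normalCone (psdCone n) X)
    (hN : Γ + H - W ∈ normalCone (psdCone n) (X + W)) {q : ℝ}
    (hq : IsGLB ((fun V => 2 * curvature X Γ V + ‖V - H‖ ^ 2) '' criticalCone X Γ) q) :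
    |‖W - H‖ ^ 2 - 2 * ⟪Γ, W⟫ - q| ≤ 10 * κ * ‖H‖ ^ 3 := by
  set r := ‖W - H‖ ^ 2 - 2 * ⟪Γ, W⟫
  have hrq : r ≤ q + 8 * κ * ‖H‖ ^ 3 + 16 * κ ^ 2 * ‖H‖ ^ 4 := by
    have : r - (8 * κ * ‖H‖ ^ 3 + 16 * κ ^ 2 * ‖H‖ ^ 4) ≤ q := hq.2 <| by
      rintro _ ⟨V, hV, rfl⟩
      linarith [norm_sub_sq_sub_inner_le_of_mem_criticalCone hκ hX hΓ hN hV]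
    linarith
  have hqr : q ≤ r + 4 * κ * ‖H‖ ^ 3 + 3 * κ ^ 2 * ‖H‖ ^ 4 := by
    have hXΓ := (mem_normalCone_psdCone_iff.mp hΓ).2.2
    have hle := hq.1 ⟨_, criticalPart_mem_criticalCone hXΓ hN.1, rfl⟩
    simp only [curvature_criticalPart] at hle
    linarith [curvature_le_of_mem_normalCone hκ hX hΓ hN,
      norm_criticalPart_sub_sq_le hκ hΓspec hΓ hN]
  rcases le_total (κ * ‖H‖) (1 / 8) with hsmall | hlarge
  · have : κ ^ 2 * ‖H‖ ^ 4 ≤ 1 / 8 * (κ * ‖H‖ ^ 3) := by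
      calc κ ^ 2 * ‖H‖ ^ 4 = κ * ‖H‖ * (κ * ‖H‖ ^ 3) := by ring
        _ ≤ 1 / 8 * (κ * ‖H‖ ^ 3) := by gcongr
    have : 0 ≤ κ * ‖H‖ ^ 3 := by positivity
    rw [abs_le]
    constructor <;> linarith
  · obtain ⟨hr_nonneg, hr_le⟩ := norm_sub_sq_sub_inner_mem_Icc hΓ hN
    obtain ⟨hq_nonneg, hq_le⟩ := isGLB_mem_Icc hΓ hq
    calc |r - q| ≤ ‖H‖ ^ 2 := abs_sub_le_of_nonneg_of_le hr_nonneg hr_le hq_nonneg hq_le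
      _ ≤ 10 * (κ * ‖H‖) * ‖H‖ ^ 2 := le_mul_of_one_le_left (sq_nonneg _) (by linarith)
      _ = 10 * κ * ‖H‖ ^ 3 := by ring

end Transfer

theorem exists_moreauEnv_eq_coe_and_abs_sub_le {X Γ : SymMat n}
    (hΓ : Γ ∈ normalCone (psdCone n) X) {c : ℝ} (hc : 0 < c)
    (hspec : ∀ μ ∈ spectrum ℝ (X + Γ).mat, μ ≠ 0 → c ≤ |μ|) (H : SymMat n) :
    ∃ a b q : ℝ,
      moreauEnv 1 (convIndicator (psdCone n)) (X + Γ + H) = (a : EReal) ∧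
      moreauEnv 1 (convIndicator (psdCone n)) (X + Γ) = (b : EReal) ∧
      moreauEnv (1 / 2) (secondSubderiv (convIndicator (psdCone n)) X Γ) H = (q : EReal) ∧
      |a - b - (inner ℝ (metricProj (nsdCone n) (X + Γ)) H + 1 / 2 * q)| ≤ 5 / c * ‖H‖ ^ 3 := by
  obtain ⟨Z, N, hN, hsum⟩ := exists_mem_normalCone_psdCone_add_eq (X + Γ + H)
  obtain ⟨W, rfl⟩ : ∃ W, Z = X + W := ⟨Z - X, (add_sub_cancel X Z).symm⟩
  obtain rfl : N = Γ + H - W := by rw [← sub_eq_of_eq_add' hsum]; abel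
  obtain ⟨q, hq, hglb⟩ := exists_moreauEnv_secondSubderiv_eq_coe hΓ H
  have hinv {μ : ℝ} (hμ : μ ≠ 0 → μ ∈ spectrum ℝ (X + Γ).mat) : |μ⁻¹| ≤ c⁻¹ := by
    rcases eq_or_ne μ 0 with rfl | hμ0
    · simpa using hc.le
    · rw [abs_inv]
      exact inv_anti₀ hc (hspec μ (hμ hμ0) hμ0)
  have herr := abs_norm_sub_sq_sub_inner_sub_le (inv_nonneg.mpr hc.le)
    (fun μ hμ => hinv fun hμ0 => (mem_spectrum_add_iff_of_mem_normalCone hΓ hμ0).mpr (.inl hμ))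
    (fun μ hμ => hinv fun hμ0 => (mem_spectrum_add_iff_of_mem_normalCone hΓ hμ0).mpr (.inr hμ))
    hΓ hN hglb
  have hproj : metricProj (nsdCone n) (X + Γ) = Γ := by
    rw [add_comm, metricProj_add (mem_normalCone_nsdCone hΓ)]
  have hident := norm_sq_sub_norm_sq_eq_of_add_eq_add hsum
  rw [add_sub_cancel_left] at hident
  refine ⟨_, _, q, hsum ▸ moreauEnv_convIndicator_add one_pos hN,
    moreauEnv_convIndicator_add one_pos hΓ, hq, ?_⟩
  rw [hproj, div_eq_mul_inv 5 c, abs_le]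
  rw [← hident, abs_le] at herr
  constructor <;> linarith

end SymMat

end FrobeniusNorm

theorem mainTheorem4_general {n : ℕ} (X A : SymMat n) {r : ℝ}
    (hneg : ∀ i, A.eig i < 0 → r < |A.eig i|) :
    ∃ l > (0 : ℝ), ∀ Γ ∈ normalCone (psdCone n) X, ‖X + Γ - A‖ ≤ r →
      {i | (X + Γ).eig i < 0} = {i | A.eig i < 0} → ∀ H : SymMat n,
        ∃ a b q : ℝ,
          moreauEnv 1 (convIndicator (psdCone n)) (X + Γ + H) = (a : EReal) ∧
          moreauEnv 1 (convIndicator (psdCone n)) (X + Γ) = (b : EReal) ∧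
          moreauEnv (1 / 2) (secondSubderiv (convIndicator (psdCone n)) X Γ) H = (q : EReal) ∧
          |a - b - (inner ℝ (metricProj (nsdCone n) (X + Γ)) H + 1 / 2 * q)| ≤ l * ‖H‖ ^ 3 := by
  obtain ⟨c, hc, hspec⟩ := SymMat.exists_pos_forall_le_abs_of_mem_spectrum X A hneg
  exact ⟨5 / c, by positivity, fun Γ hΓ hr hsame =>
    SymMat.exists_moreauEnv_eq_coe_and_abs_sub_le hΓ hc (hspec Γ hΓ hr hsame)⟩

theorem mainTheorem4 {𝒳 : Type*} {n : ℕ} (G : 𝒳 → SymMat n) (xbar : 𝒳) (Γbar : SymMat n)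
    (hΓbar : Γbar ∈ normalCone (psdCone n) (G xbar))
    (r : ℝ) (hr : 0 < r)
    (hgap : ∀ i j, (G xbar + Γbar).eig j < (G xbar + Γbar).eig i →
      r < ((G xbar + Γbar).eig i - (G xbar + Γbar).eig j) / 3)
    (hneg : ∀ i, (G xbar + Γbar).eig i < 0 → r < |(G xbar + Γbar).eig i|) :
    ∃ l > (0 : ℝ), ∃ δ > (0 : ℝ), ∀ A Γ : SymMat n,
      A = G xbar + Γ →
      A ∈ Metric.closedBall (G xbar + Γbar) r →
      Γ ∈ normalCone (psdCone n) (G xbar) →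
      SamePartition A (G xbar + Γbar) →
      ∀ H : SymMat n, ‖H‖ ≤ δ →
        ∃ a b q : ℝ,
          moreauEnv 1 (convIndicator (psdCone n)) (A + H) = (a : EReal) ∧
          moreauEnv 1 (convIndicator (psdCone n)) A = (b : EReal) ∧
          moreauEnv (1 / 2) (secondSubderiv (convIndicator (psdCone n)) (G xbar) Γ) H
            = (q : EReal) ∧
          |a - b - (inner ℝ (metricProj (nsdCone n) A) H + 1 / 2 * q)| ≤ l * ‖H‖ ^ 3 := by
  obtain ⟨l, hl, hbound⟩ := mainTheorem4_general (G xbar) (G xbar + Γbar) hneg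
  refine ⟨l, hl, 1, one_pos, ?_⟩
  rintro _ Γ rfl hA hΓ hpart H -
  exact hbound Γ hΓ (mem_closedBall_iff_norm.mp hA) hpart.2.2.2 H
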